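/- Let $\mathcal A$ be a complete and cocomplete abelian category, and write $\mathrm{Ch}(\mathcal A)$ for the category of unbounded chain complexes in $\mathcal A$. For an object $P$, a map $f\colon X\to Y$ of $\mathcal A$ is \emph{$P$-epic} if $\mathcal A(P,X)\to\mathcal A(P,Y)$ is surjective. A \emph{projective class} on a category consists of a collection $\mathcal P$ of objects and a collection $\mathcal E$ of maps such that $\mathcal E$ is exactly the collection of maps that are $P$-epic for all $P\in\mathcal P$, $\mathcal P$ is exactly the collection of objects $P$ such that every map in $\mathcal E$ is $P$-epic, and every object $Y$ admits a map $P\to Y$ in $\mathcal E$ with $P\in\mathcal P$. Let $(\mathcal P,\mathcal E)$ be a projective class on $\mathcal A$. A chain map $f$ is a \emph{$\mathcal P$-equivalence} if $\mathcal A(P,f)$ is a quasi-isomorphism for every $P\in\mathcal P$; a \emph{$\mathcal P$-fibration} if $\mathcal A(P,f)$ is surjective in each degree for every $P\in\mathcal P$; and a \emph{$\mathcal P$-cofibration} if it has the left lifting property with respect to all maps that are both $\mathcal P$-fibrations and $\mathcal P$-equivalences. A complex $C$ is \emph{$\mathcal P$-cofibrant} if $0\to C$ is a $\mathcal P$-cofibration.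 We say that \emph{(functorial) cofibrant replacements exist} if there are a functor $Q\colon\mathrm{Ch}(\mathcal A)\to\mathrm{Ch}(\mathcal A)$ and a natural transformation $q\colon Q\to\mathrm{id}$ such that, for every $X$, the complex $QX$ is $\mathcal P$-cofibrant and $q_X\colon QX\to X$ is a $\mathcal P$-fibration and a $\mathcal P$-equivalence. Model categories are required to be complete and cocomplete and to have functorial factorizations; a model structure is \emph{proper} if weak equivalences are stable under pullback along fibrations and under pushout along cofibrations. \textbf{Theorem.} (1) The $\mathcal P$-equivalences, $\mathcal P$-fibrations and $\mathcal P$-cofibrations make $\mathrm{Ch}(\mathcal A)$ a model category if and only if functorial cofibrant replacements exist. (2) When this model structure exists, it is proper. (3) Functorial cofibrant replacements exist in each of the following cases. Case A. There are an abelian category $\mathcal B$ and a functor $U\colon\mathcal A\to\mathcal B$ that has a left adjoint $F$ and preserves countable coproducts, such that $(\mathcal P,\mathcal E)$ is the pullback along $U$ of the trivial projective class on $\mathcal B$ (all objects, and the split epimorphisms); that is, $\mathcal P$ consists of the retracts of the objects $FM$ with $M\in\mathcal B$, and $\mathcal E$ consists of the maps $f$ such that $Uf$ is a split epimorphism. Case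 B. For some cardinal $\kappa$ there are enough $\kappa$-small $\mathcal P$-projectives, and $\mathcal P$-resolutions can be chosen functorially. Here an object $P$ is \emph{$\kappa$-small} if, for every ordinal $\gamma$ of cofinality greater than $\kappa$ (successor ordinals have cofinality $1$) and every sequence $(X^\alpha)_{\alpha<\gamma}$ in $\mathcal A$ such that $\operatorname{colim}_{\alpha<\lambda}X^\alpha\to X^\lambda$ is an isomorphism for all limit ordinals $\lambda<\gamma$ and every map $X^\alpha\to X^\beta$ ($\alpha\le\beta$) is a split monomorphism with cokernel in $\mathcal P$, the natural map $\operatorname{colim}_{\alpha<\gamma}\mathcal A(P,X^\alpha)\to\mathcal A(P,\operatorname{colim}_{\alpha<\gamma}X^\alpha)$ is an isomorphism. There are \emph{enough} of them if every map that is $P$-epic for all $\kappa$-small $P\in\mathcal P$ lies in $\mathcal E$. Functorial $\mathcal P$-resolutions assign to each object $M$, naturally in $M$, a sequence $\cdots\to P_2\to P_1\to P_0\to M\to 0$ with all $P_i\in\mathcal P$ in which consecutive maps compose to zero and which becomes exact after applying $\mathcal A(P,-)$ for each $P\in\mathcal P$. -/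

import Mathlib

open CategoryTheory Limits Opposite HomotopicalAlgebra
open scoped ZeroObject

universe v u v₂ u₂

/-- Every `P`-element of `Y` (that is, every map `P ⟶ Y`) lifts along `f : X ⟶ Y`:
the map `f` is `P`-epic. -/
def IsEpicFor {A : Type u} [Category.{v} A] (P : A) {X Y : A} (f : X ⟶ Y) : Prop :=
  Function.Surjective (fun a : P ⟶ X => a ≫ f)

/-- A projective class on `A`: a collection of objects (the relative projectives) and a collection
of maps (the relative epimorphisms) that determine each other, with enough relative projectives. -/
structure ProjectiveClass (A : Type u) [Category.{v} A] where
  /-- the relative projectives -/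
  proj : ObjectProperty A
  /-- the relative epimorphisms -/
  epi : MorphismProperty A
  epi_iff : ∀ {X Y : A} (f : X ⟶ Y), epi f ↔ ∀ P : A, proj P → IsEpicFor P f
  proj_iff : ∀ P : A, proj P ↔ ∀ {X Y : A} (f : X ⟶ Y), epi f → IsEpicFor P f
  exists_epi : ∀ Y : A, ∃ (P : A) (f : P ⟶ Y), proj P ∧ epi f

namespace ProjectiveClass

/-- The trivial projective class: all objects, and the split epimorphisms. -/
def trivial (B : Type u) [Category.{v} B] : ProjectiveClass B where
  proj := fun _ => True
  epi := fun _ _ f => IsSplitEpi f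
  epi_iff := by
    intro X Y f
    constructor
    · intro hf P _ b
      exact ⟨b ≫ section_ f, by simp⟩
    · intro h
      obtain ⟨s, hs⟩ := h Y True.intro (𝟙 Y)
      exact ⟨⟨⟨s, hs⟩⟩⟩
  proj_iff := by
    intro P
    refine ⟨fun _ X Y f hf b => ?_, fun _ => True.intro⟩
    exact ⟨b ≫ section_ f, by simp⟩
  exists_epi := fun Y => ⟨Y, 𝟙 Y, True.intro, inferInstance⟩

section Pullback

variable {A : Type u} [Category.{v} A] {B : Type u₂} [Category.{v₂} B]

lemma isEpicFor_leftAdjoint_iff {F : B ⥤ A} {U : A ⥤ B} (adj : F ⊣ U) (M : B) {X Y : A}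
    (f : X ⟶ Y) : IsEpicFor (F.obj M) f ↔ IsEpicFor M (U.map f) := by
  constructor
  · intro h b
    obtain ⟨a, ha⟩ := h ((adj.homEquiv M Y).symm b)
    refine ⟨adj.homEquiv M X a, ?_⟩
    have ha' : a ≫ f = (adj.homEquiv M Y).symm b := ha
    change adj.homEquiv M X a ≫ U.map f = b
    rw [← Adjunction.homEquiv_naturality_right, ha', Equiv.apply_symm_apply]
  · intro h b
    obtain ⟨a, ha⟩ := h (adj.homEquiv M Y b)
    refine ⟨(adj.homEquiv M X).symm a, ?_⟩
    have ha' : a ≫ U.map f = adj.homEquiv M Y b := ha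
    change (adj.homEquiv M X).symm a ≫ f = b
    rw [← Adjunction.homEquiv_naturality_right_symm, ha', Equiv.symm_apply_apply]

lemma isEpicFor_of_retract {P R : A} (r : Retract R P) {X Y : A} {f : X ⟶ Y}
    (h : IsEpicFor P f) : IsEpicFor R f := by
  intro b
  obtain ⟨a, ha⟩ := h (r.r ≫ b)
  have ha' : a ≫ f = r.r ≫ b := ha
  refine ⟨r.i ≫ a, ?_⟩
  change (r.i ≫ a) ≫ f = b
  rw [Category.assoc, ha', r.retract_assoc]

lemma exists_isEpi_leftAdjoint (𝓟 : ProjectiveClass B) {F : B ⥤ A} {U : A ⥤ B} (adj : F ⊣ U)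
    (Y : A) : ∃ (M : B) (f : F.obj M ⟶ Y), 𝓟.proj M ∧ 𝓟.epi (U.map f) := by
  obtain ⟨M, g, hM, hg⟩ := 𝓟.exists_epi (U.obj Y)
  refine ⟨M, (adj.homEquiv M Y).symm g, hM, ?_⟩
  rw [𝓟.epi_iff] at hg ⊢
  intro P hP b
  obtain ⟨a, ha⟩ := hg P hP b
  have ha' : a ≫ g = b := ha
  refine ⟨a ≫ adj.unit.app M, ?_⟩
  change (a ≫ adj.unit.app M) ≫ U.map _ = b
  rw [Category.assoc, ← Adjunction.homEquiv_unit, Equiv.apply_symm_apply, ha']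

/-- The pullback of a projective class along a right adjoint `U` with left adjoint `F`: its
projectives are the retracts of the objects `F M` with `M` a projective, and its epimorphisms are
the maps that `U` sends to epimorphisms. -/
def pullback (𝓟 : ProjectiveClass B) {F : B ⥤ A} {U : A ⥤ B} (adj : F ⊣ U) :
    ProjectiveClass A where
  proj := fun X => ∃ M : B, 𝓟.proj M ∧ Nonempty (Retract X (F.obj M))
  epi := fun _ _ f => 𝓟.epi (U.map f)
  epi_iff := by
    intro X Y f
    rw [𝓟.epi_iff]
    constructor
    · rintro h P ⟨M, hM, ⟨r⟩⟩
      exact isEpicFor_of_retract r ((isEpicFor_leftAdjoint_iff adj M f).2 (h M hM))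
    · intro h M hM
      exact (isEpicFor_leftAdjoint_iff adj M f).1 (h _ ⟨M, hM, ⟨Retract.refl _⟩⟩)
  proj_iff := by
    intro P
    constructor
    · rintro ⟨M, hM, ⟨r⟩⟩ X Y f hf
      exact isEpicFor_of_retract r
        ((isEpicFor_leftAdjoint_iff adj M f).2 ((𝓟.epi_iff _).1 hf M hM))
    · intro h
      obtain ⟨M, f, hM, hf⟩ := exists_isEpi_leftAdjoint 𝓟 adj P
      obtain ⟨s, hs⟩ := h f hf (𝟙 P)
      exact ⟨M, hM, ⟨⟨s, f, hs⟩⟩⟩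
  exists_epi := by
    intro Y
    obtain ⟨M, f, hM, hf⟩ := exists_isEpi_leftAdjoint 𝓟 adj Y
    exact ⟨F.obj M, f, ⟨M, hM, ⟨Retract.refl _⟩⟩, hf⟩

end Pullback

variable {A : Type u} [Category.{v} A] [Abelian A] (𝓟 : ProjectiveClass A)

/-! ### The three classes of chain maps -/

/-- The chain complex `A(P, X)` of `P`-elements, functorially in the complex `X`. -/
noncomputable def elementsFunctor (P : A) :
    ChainComplex A ℤ ⥤ ChainComplex AddCommGrpCat.{v} ℤ :=
  (preadditiveCoyoneda.obj (op P)).mapHomologicalComplex (ComplexShape.down ℤ)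

/-- The relative equivalences: chain maps that are quasi-isomorphisms on `P`-elements for every
relative projective `P`. -/
def equivalences : MorphismProperty (ChainComplex A ℤ) :=
  fun _ _ f => ∀ P : A, 𝓟.proj P → QuasiIso ((elementsFunctor P).map f)

/-- The relative fibrations: chain maps that are surjective on `P`-elements, in each degree, for
every relative projective `P`. -/
def fibrations : MorphismProperty (ChainComplex A ℤ) :=
  fun _ _ f => ∀ P : A, 𝓟.proj P → ∀ n : ℤ, IsEpicFor P (f.f n)

/-- The relative cofibrations: chain maps with the left lifting property with respect to the maps
that are both relative fibrations and relative equivalences. -/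
def cofibrations : MorphismProperty (ChainComplex A ℤ) :=
  (𝓟.fibrations ⊓ 𝓟.equivalences).llp

/-- A complex is relatively cofibrant if the map to it from `0` is a relative cofibration. -/
def IsCofibrant (X : ChainComplex A ℤ) : Prop :=
  𝓟.cofibrations (0 : (0 : ChainComplex A ℤ) ⟶ X)

/-- Functorial cofibrant replacements exist: there are a functor `Q` and a natural map
`Q X ⟶ X` that is a relative fibration and a relative equivalence, with `Q X` cofibrant. -/
def HasFunctorialCofibrantReplacements : Prop :=
  ∃ (Q : ChainComplex A ℤ ⥤ ChainComplex A ℤ) (q : Q ⟶ 𝟭 (ChainComplex A ℤ)),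
    ∀ X : ChainComplex A ℤ,
      𝓟.IsCofibrant (Q.obj X) ∧ 𝓟.fibrations (q.app X) ∧ 𝓟.equivalences (q.app X)

/-! ### Exactness and resolutions -/

/-- The sequence `X ⟶ Y ⟶ Z` is exact relative to the projective class. -/
def ExactSeq {X Y Z : A} (f : X ⟶ Y) (g : Y ⟶ Z) : Prop :=
  f ≫ g = 0 ∧ ∀ P : A, 𝓟.proj P →
    Function.Exact (fun a : P ⟶ X => a ≫ f) (fun b : P ⟶ Y => b ≫ g)

/-- The complex `R`, with the augmentation `ε`, is a resolution of `M` relative to the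
projective class: `⋯ ⟶ R₂ ⟶ R₁ ⟶ R₀ ⟶ M ⟶ 0` is relatively exact and
each `Rₙ` is a relative projective. -/
structure IsResolution (R : ChainComplex A ℕ) (M : A) (ε : R.X 0 ⟶ M) : Prop where
  proj : ∀ n : ℕ, 𝓟.proj (R.X n)
  exact_target : 𝓟.ExactSeq ε (0 : M ⟶ 0)
  exact_zero : 𝓟.ExactSeq (R.d 1 0) ε
  exact_succ : ∀ n : ℕ, 𝓟.ExactSeq (R.d (n + 2) (n + 1)) (R.d (n + 1) n)

/-- Resolutions relative to the projective class can be chosen functorially. -/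
def HasFunctorialResolutions : Prop :=
  ∃ (R : A ⥤ ChainComplex A ℕ)
    (ε : R ⋙ HomologicalComplex.eval A (ComplexShape.down ℕ) 0 ⟶ 𝟭 A),
    ∀ M : A, 𝓟.IsResolution (R.obj M) M (ε.app M)

/-! ### Smallness -/

/-- The split monomorphisms whose cokernel is a relative projective. -/
def splitMonosWithProjCokernel : MorphismProperty A :=
  fun _ _ f => IsSplitMono f ∧ 𝓟.proj (cokernel f)

end ProjectiveClass

/-- `P` is `κ`-small relative to the class of maps `M`: for every ordinal `γ` (given as a
well-ordered type `J`) of cofinality greater than `κ`, the functor `A(P, -)` preserves the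
colimit of each colimit-preserving sequence of length `γ` whose maps all lie in `M`. -/
def IsSmallRelativeTo {A : Type u} [Category.{v} A] (κ : Cardinal.{v}) (M : MorphismProperty A)
    (P : A) : Prop :=
  ∀ (J : Type v) [LinearOrder J] [WellFoundedLT J], κ < Order.cof J →
    ∀ X : J ⥤ A, X.IsWellOrderContinuous → (∀ {i j : J} (h : i ⟶ j), M (X.map h)) →
      PreservesColimit X (coyoneda.obj (op P))

namespace ProjectiveClass

/-- There are enough `κ`-small relative projectives: the relative projectives that are `κ`-small
relative to the split monomorphisms with relatively projective cokernel suffice to detect the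
relative epimorphisms. -/
def HasEnoughSmallProjectives {A : Type u} [Category.{v} A] [Abelian A]
    (𝓟 : ProjectiveClass A) (κ : Cardinal.{v}) : Prop :=
  ∀ {X Y : A} (f : X ⟶ Y),
    (∀ P : A, 𝓟.proj P → IsSmallRelativeTo κ 𝓟.splitMonosWithProjCokernel P → IsEpicFor P f) →
      𝓟.epi f

end ProjectiveClass

/-! ### Model structures with functorial factorizations, and properness -/

/-- The weak equivalences `W`, fibrations `Fib` and cofibrations `Cof` make `C` a (Quillen) model
category, in the sense that `C` is complete and cocomplete and the factorizations are
functorial. -/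
structure FormsModelCategory {C : Type u} [Category.{v} C] (W Fib Cof : MorphismProperty C) :
    Prop where
  hasLimits : HasLimits C
  hasColimits : HasColimits C
  exists_modelCategory : ∃ _ : ModelCategory C,
    HomotopicalAlgebra.weakEquivalences C = W ∧ HomotopicalAlgebra.fibrations C = Fib ∧
      HomotopicalAlgebra.cofibrations C = Cof
  functorial_trivialCof_fib : (Cof ⊓ W).HasFunctorialFactorization Fib
  functorial_cof_trivialFib : Cof.HasFunctorialFactorization (Fib ⊓ W)

/-- Properness: weak equivalences are stable under pullback along fibrations (right properness)
and under pushout along cofibrations (left properness). -/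
structure IsProperStructure {C : Type u} [Category.{v} C] (W Fib Cof : MorphismProperty C) :
    Prop where
  right_proper : ∀ {X' X Y' Y : C} {g' : X' ⟶ X} {p' : X' ⟶ Y'} {p : X ⟶ Y} {g : Y' ⟶ Y},
    IsPullback g' p' p g → Fib p → W g → W g'
  left_proper : ∀ {X X' Y Y' : C} {g : X ⟶ X'} {i : X ⟶ Y} {i' : X' ⟶ Y'} {g' : Y ⟶ Y'},
    IsPushout g i i' g' → Cof i → W g → W g'

/-! ### Chain maps, element by element -/

section AddCommGrp

variable {K L : ChainComplex AddCommGrpCat.{v} ℤ}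

/-! On `P`-elements, being a fibration and an equivalence is one condition, `LiftsCycles`: if `e` is
a cycle of `E` and `f e = d x`, then some `e'` has `d e' = e` and `f e' = x`. Such pairs `(x, e)`
are cycles of the mapping cone of `f`, so factorizations come from covering the cone.

Given `q : K ⟶ cone f`, the complex `attach q` is `E ⊕ K` with differential twisted by `q`, and `f`
factors through it. If `K` is cofibrant, the first factor is a cofibration
(`cofibrations_attachInl`); if `q` is a trivial fibration, so is the second
(`trivialFibrations_attachDesc`). A cofibrant replacement of the cone thus yields one factorization.
The other is `E ⟶ E ⊕ path (Q X) ⟶ X`: maps out of a path complex are graded maps, so its first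
factor lifts against all fibrations. A retract argument completes the model structure; conversely,
factoring `0 ⟶ X` gives replacements. Cofibrations are degreewise split, from which left properness
follows on elements.

For existence, the attaching construction is iterated from `0`, functorially in `X`
(`exists_attachTower`). In Case B the cycles of the cone are covered by relative projectives with
zero differential. The length has cofinality greater than `κ`, so for small `P` every lifting
problem appears at some stage and is solved at the next. By `liftsCycles_iff` lifting cycles means
that certain maps of `A` are relative epimorphisms, which small projectives detect.

In Case A the complex `F U (cone)` is attached `ω` times. No smallness is available; instead, after
`U`, each map from one cone to the next is null-homotopic. The cone of the colimit is the cokernel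
of a degreewise split `1 - S` on the coproduct `T` of the cones. As `U` preserves this coproduct, `U
S` is null-homotopic and `U` of the cokernel is acyclic on elements
(`exists_boundary_of_telescope`). -/

lemma AddCommGrpCat.exists_iCycles_eq (K : ChainComplex AddCommGrpCat.{v} ℤ) {j k : ℤ}
    (hjk : k + 1 = j) (a : K.X j) (ha : K.d j k a = 0) :
    ∃ z : K.cycles j, K.iCycles j z = a := by
  have hk : (ComplexShape.down ℤ).next j = k := ComplexShape.next_eq' _ hjk
  subst hk
  exact ⟨(K.sc j).abCyclesIso.inv ⟨a, ha⟩, (K.sc j).abCyclesIso_inv_apply_iCycles ⟨a, ha⟩⟩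

lemma AddCommGrpCat.iCycles_injective (K : ChainComplex AddCommGrpCat.{v} ℤ) (j : ℤ) :
    Function.Injective (K.iCycles j) :=
  (AddCommGrpCat.mono_iff_injective _).1 inferInstance

lemma AddCommGrpCat.homologyπ_eq_zero_iff (K : ChainComplex AddCommGrpCat.{v} ℤ) {i j : ℤ}
    (hij : j + 1 = i) (z : K.cycles j) :
    K.homologyπ j z = 0 ↔ ∃ b : K.X i, K.d i j b = K.iCycles j z := by
  have hi : (ComplexShape.down ℤ).prev j = i := ComplexShape.prev_eq' _ hij
  have hex := ShortComplex.exact_of_g_is_cokernel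
    (ShortComplex.mk (K.toCycles i j) (K.homologyπ j) (by simp)) (K.homologyIsCokernel i j hi)
  rw [ShortComplex.ab_exact_iff_function_exact] at hex
  rw [hex z]
  refine exists_congr fun b => ?_
  rw [← (iCycles_injective K j).eq_iff]
  change (K.toCycles i j ≫ K.iCycles j) b = _ ↔ _
  rw [K.toCycles_i]

/-- The condition is acyclicity of the mapping cone. Injectivity on homology is read off from `a`
being a boundary, surjectivity from the case `a = 0`. -/
lemma AddCommGrpCat.quasiIso_iff (φ : K ⟶ L) :
    QuasiIso φ ↔ ∀ (i j k : ℤ), j + 1 = i → k + 1 = j → ∀ (a : K.X j) (b : L.X i),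
      K.d j k a = 0 → φ.f j a = L.d i j b →
        ∃ (a' : K.X i) (b' : L.X (i + 1)), K.d i j a' = a ∧ φ.f i a' = b + L.d (i + 1) i b' := by
  have hφ (j : ℤ) (z : K.cycles j) :
      L.iCycles j (HomologicalComplex.cyclesMap φ j z) = φ.f j (K.iCycles j z) := by
    rw [← ConcreteCategory.comp_apply, ← ConcreteCategory.comp_apply,
      HomologicalComplex.cyclesMap_i]
  have hπ (j : ℤ) (z : K.cycles j) :
      HomologicalComplex.homologyMap φ j (K.homologyπ j z) =
        L.homologyπ j (HomologicalComplex.cyclesMap φ j z) := by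
    rw [← ConcreteCategory.comp_apply, ← ConcreteCategory.comp_apply,
      HomologicalComplex.homologyπ_naturality]
  have hdi (K : ChainComplex AddCommGrpCat.{v} ℤ) (j k : ℤ) (z : K.cycles j) :
      K.d j k (K.iCycles j z) = 0 := by
    rw [← ConcreteCategory.comp_apply, HomologicalComplex.iCycles_d]; rfl
  have hφd (i j : ℤ) (a : K.X i) : φ.f j (K.d i j a) = L.d i j (φ.f i a) := by
    rw [← ConcreteCategory.comp_apply, ← ConcreteCategory.comp_apply, φ.comm]
  have hsurj (K : ChainComplex AddCommGrpCat.{v} ℤ) (j : ℤ) :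
      Function.Surjective (K.homologyπ j) :=
    (AddCommGrpCat.epi_iff_surjective _).1 inferInstance
  constructor
  · intro h i j k hij hjk a b ha hab
    obtain ⟨z, rfl⟩ := exists_iCycles_eq K hjk a ha
    have hiso (n : ℤ) : Function.Bijective (HomologicalComplex.homologyMap φ n) :=
      ConcreteCategory.bijective_of_isIso _
    have hz : K.homologyπ j z = 0 := by
      apply (hiso j).1
      rw [hπ, map_zero, homologyπ_eq_zero_iff L hij]
      exact ⟨b, by rw [hφ, hab]⟩
    obtain ⟨a₀, ha₀⟩ := (homologyπ_eq_zero_iff K hij z).1 hz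
    -- `φ a₀ - b` is a cycle; its class comes from a cycle `z'` of `K`, and subtracting `z'` from
    -- `a₀` leaves only a boundary as error.
    obtain ⟨w, hw⟩ := exists_iCycles_eq L hij (φ.f i a₀ - b) (by
      rw [map_sub, ← hφd, ha₀, hab, sub_self])
    obtain ⟨c, hc⟩ := (hiso i).2 (L.homologyπ i w)
    obtain ⟨z', rfl⟩ := hsurj K i c
    rw [hπ, ← sub_eq_zero, ← map_sub, homologyπ_eq_zero_iff L (i := i + 1) rfl] at hc
    obtain ⟨b', hb'⟩ := hc
    rw [map_sub, hφ, hw] at hb'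
    refine ⟨a₀ - K.iCycles i z', -b', ?_, ?_⟩
    · rw [map_sub, hdi, ha₀, sub_zero]
    · rw [map_sub, map_neg, hb']
      abel
  · intro h
    rw [_root_.quasiIso_iff]
    intro j
    rw [quasiIsoAt_iff_isIso_homologyMap, ConcreteCategory.isIso_iff_bijective]
    constructor
    · rw [injective_iff_map_eq_zero]
      intro c hc
      obtain ⟨z, rfl⟩ := hsurj K j c
      rw [hπ, homologyπ_eq_zero_iff L (i := j + 1) rfl] at hc
      obtain ⟨b, hb⟩ := hc
      rw [hφ] at hb
      obtain ⟨a', b', h₁, -⟩ := h (j + 1) j (j - 1) rfl (by ring) _ b (hdi K j _ z) hb.symm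
      exact (homologyπ_eq_zero_iff K rfl z).2 ⟨a', h₁⟩
    · intro c
      obtain ⟨w, rfl⟩ := hsurj L j c
      obtain ⟨a', b', h₁, h₂⟩ := h j (j - 1) (j - 1 - 1) (by ring) (by ring) 0 (L.iCycles j w)
        (map_zero _) (by rw [map_zero, hdi])
      obtain ⟨z, rfl⟩ := exists_iCycles_eq K (k := j - 1) (by ring) a' h₁
      refine ⟨K.homologyπ j z, ?_⟩
      rw [hπ, ← sub_eq_zero, ← map_sub, homologyπ_eq_zero_iff L (i := j + 1) rfl]
      exact ⟨b', by rw [map_sub, hφ, h₂, add_sub_cancel_left]⟩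

end AddCommGrp

/-! ### Relative equivalences and trivial fibrations on `P`-elements. -/

namespace ChainComplex

section Elements

variable {A : Type u} [Category.{v} A] [Preadditive A]

/-- On `P`-elements, the mapping cone of `f` is acyclic. -/
def ConeExact (P : A) {E X : ChainComplex A ℤ} (f : E ⟶ X) : Prop :=
  ∀ (i j k : ℤ), j + 1 = i → k + 1 = j → ∀ (e : P ⟶ E.X j) (x : P ⟶ X.X i),
    e ≫ E.d j k = 0 → e ≫ f.f j = x ≫ X.d i j →
      ∃ (e' : P ⟶ E.X i) (x' : P ⟶ X.X (i + 1)),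
        e' ≫ E.d i j = e ∧ e' ≫ f.f i = x + x' ≫ X.d (i + 1) i

/-- On `P`-elements, each cycle `e` of `E` whose image bounds some `x` bounds a lift of `x`. -/
def LiftsCycles (P : A) {E X : ChainComplex A ℤ} (f : E ⟶ X) : Prop :=
  ∀ (i j k : ℤ), j + 1 = i → k + 1 = j → ∀ (e : P ⟶ E.X j) (x : P ⟶ X.X i),
    e ≫ E.d j k = 0 → e ≫ f.f j = x ≫ X.d i j →
      ∃ e' : P ⟶ E.X i, e' ≫ E.d i j = e ∧ e' ≫ f.f i = x

lemma LiftsCycles.coneExact {P : A} {E X : ChainComplex A ℤ} {f : E ⟶ X}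
    (h : LiftsCycles P f) : ConeExact P f := by
  intro i j k hij hjk e x he hx
  obtain ⟨e', h₁, h₂⟩ := h i j k hij hjk e x he hx
  exact ⟨e', 0, h₁, by rw [h₂, zero_comp, add_zero]⟩

/-- The property is used twice: first to lift the cycle `d x` to a cycle `e`, then to lift `x` over
`e`. -/
lemma LiftsCycles.isEpicFor {P : A} {E X : ChainComplex A ℤ} {f : E ⟶ X}
    (h : LiftsCycles P f) (n : ℤ) : IsEpicFor P (f.f n) := by
  intro x
  obtain ⟨e, h₁, h₂⟩ := h (n - 1) (n - 1 - 1) (n - 1 - 1 - 1) (by ring) (by ring) 0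
    (x ≫ X.d n (n - 1)) (by simp) (by simp)
  obtain ⟨e', -, h₄⟩ := h n (n - 1) (n - 1 - 1) (by ring) (by ring) e x h₁ h₂
  exact ⟨e', h₄⟩

/-- The error `d x'` is removed by subtracting the boundary of a lift of `x'`. -/
lemma ConeExact.liftsCycles {P : A} {E X : ChainComplex A ℤ} {f : E ⟶ X}
    (h : ConeExact P f) (hf : ∀ n, IsEpicFor P (f.f n)) : LiftsCycles P f := by
  intro i j k hij hjk e x he hx
  obtain ⟨e', x', h₁, h₂⟩ := h i j k hij hjk e x he hx
  obtain ⟨e'', h₃⟩ := hf (i + 1) x'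
  have h₃' : e'' ≫ f.f (i + 1) = x' := h₃
  refine ⟨e' - e'' ≫ E.d (i + 1) i, ?_, ?_⟩
  · simp [h₁]
  · rw [Preadditive.sub_comp, h₂, Category.assoc, ← f.comm, ← Category.assoc, h₃',
      add_sub_cancel_right]

lemma LiftsCycles.of_retract {P R : A} (r : Retract R P) {E X : ChainComplex A ℤ} {f : E ⟶ X}
    (h : LiftsCycles P f) : LiftsCycles R f := by
  intro i j k hij hjk e x he hx
  obtain ⟨e', h₁, h₂⟩ := h i j k hij hjk (r.r ≫ e) (r.r ≫ x) (by simp [he]) (by simp [hx])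
  exact ⟨r.i ≫ e', by simp [h₁], by simp [h₂]⟩

end Elements

end ChainComplex

namespace ProjectiveClass

variable {A : Type u} [Category.{v} A] [Abelian A] (𝓟 : ProjectiveClass A)

open ChainComplex

lemma quasiIso_elementsFunctor_map_iff (P : A) {E X : ChainComplex A ℤ} (f : E ⟶ X) :
    QuasiIso ((elementsFunctor P).map f) ↔ ConeExact P f :=
  AddCommGrpCat.quasiIso_iff _

lemma equivalences_iff {E X : ChainComplex A ℤ} (f : E ⟶ X) :
    𝓟.equivalences f ↔ ∀ P, 𝓟.proj P → ConeExact P f :=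
  forall₂_congr fun P _ => quasiIso_elementsFunctor_map_iff P f

lemma trivialFibrations_iff {E X : ChainComplex A ℤ} (f : E ⟶ X) :
    (𝓟.fibrations ⊓ 𝓟.equivalences) f ↔ ∀ P, 𝓟.proj P → LiftsCycles P f := by
  constructor
  · rintro ⟨h₁, h₂⟩ P hP
    exact ((𝓟.equivalences_iff f).1 h₂ P hP).liftsCycles (h₁ P hP)
  · intro h
    exact ⟨fun P hP n => (h P hP).isEpicFor n,
      (𝓟.equivalences_iff f).2 fun P hP => (h P hP).coneExact⟩

end ProjectiveClass

/-! ### Complexes and chain maps given by consecutive differentials. -/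

namespace ChainComplex

section

variable {A : Type u} [Category.{v} A] [Preadditive A]

/-- Degrees written `n`, `n - 1`, `n - 1 - 1` match `ofPred`, so that no transport between equal
degrees is needed. -/
lemma LiftsCycles.of_pred {P : A} {E X : ChainComplex A ℤ} {f : E ⟶ X}
    (h : ∀ (n : ℤ) (e : P ⟶ E.X (n - 1)) (x : P ⟶ X.X n), e ≫ E.d (n - 1) (n - 1 - 1) = 0 →
      e ≫ f.f (n - 1) = x ≫ X.d n (n - 1) →
        ∃ e' : P ⟶ E.X n, e' ≫ E.d n (n - 1) = e ∧ e' ≫ f.f n = x) : LiftsCycles P f := by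
  intro i j k hij hjk
  obtain rfl : j = i - 1 := by omega
  obtain rfl : k = i - 1 - 1 := by omega
  exact h i

/-- A chain complex given by its differentials `X n ⟶ X (n - 1)`. -/
def ofPred (X : ℤ → A) (d : ∀ n, X n ⟶ X (n - 1)) (h : ∀ n, d n ≫ d (n - 1) = 0) :
    ChainComplex A ℤ where
  X := X
  d i j := if hij : i - 1 = j then d i ≫ eqToHom (by rw [hij]) else 0
  shape i j hij := dif_neg fun h' => hij (by simp only [ComplexShape.down_Rel]; omega)
  d_comp_d' i j k hij hjk := by
    simp only [ComplexShape.down_Rel] at hij hjk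
    obtain rfl : j = i - 1 := by omega
    obtain rfl : k = i - 1 - 1 := by omega
    simp [h]

@[simp]
lemma ofPred_d (X : ℤ → A) (d : ∀ n, X n ⟶ X (n - 1)) (h : ∀ n, d n ≫ d (n - 1) = 0) (n : ℤ) :
    (ofPred X d h).d n (n - 1) = d n := by
  simp [ofPred]

/-- A chain map given by its components, from its compatibility with the differentials
from degree `n` to degree `n - 1`. -/
@[simps]
def homMk {X Y : ChainComplex A ℤ} (f : ∀ n, X.X n ⟶ Y.X n)
    (h : ∀ n, f n ≫ Y.d n (n - 1) = X.d n (n - 1) ≫ f (n - 1)) : X ⟶ Y where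
  f := f
  comm' i j hij := by
    simp only [ComplexShape.down_Rel] at hij
    obtain rfl : j = i - 1 := by omega
    exact h i

end

variable {A : Type u} [Category.{v} A] [Abelian A]

/-! ### Mapping cones -/

section Cone

variable {E X : ChainComplex A ℤ} (f : E ⟶ X)

/-- The mapping cone of `f : E ⟶ X`, with `X n ⊞ E (n - 1)` in degree `n`. -/
noncomputable def cone : ChainComplex A ℤ :=
  ofPred (fun n => X.X n ⊞ E.X (n - 1))
    (fun n => biprod.lift
      (biprod.fst ≫ X.d n (n - 1) - biprod.snd ≫ f.f (n - 1))
      (-(biprod.snd ≫ E.d (n - 1) (n - 1 - 1))))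
    (fun n => by
      ext <;> simp [Preadditive.sub_comp, Preadditive.comp_sub])

/-- The first projection from the mapping cone. -/
noncomputable def coneFst (n : ℤ) : (cone f).X n ⟶ X.X n :=
  (biprod.fst : X.X n ⊞ E.X (n - 1) ⟶ _)

/-- The second projection from the mapping cone. -/
noncomputable def coneSnd (n : ℤ) : (cone f).X n ⟶ E.X (n - 1) :=
  (biprod.snd : X.X n ⊞ E.X (n - 1) ⟶ _)

/-- The map to the mapping cone with given components. -/
noncomputable def coneLift {P : A} {n : ℤ} (x : P ⟶ X.X n) (e : P ⟶ E.X (n - 1)) :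
    P ⟶ (cone f).X n :=
  (biprod.lift x e : P ⟶ X.X n ⊞ E.X (n - 1))

@[simp]
lemma coneLift_fst {P : A} {n : ℤ} (x : P ⟶ X.X n) (e : P ⟶ E.X (n - 1)) :
    coneLift f x e ≫ coneFst f n = x :=
  biprod.lift_fst _ _

@[simp]
lemma coneLift_fst_assoc {P : A} {n : ℤ} (x : P ⟶ X.X n) (e : P ⟶ E.X (n - 1)) {W : A}
    (h : X.X n ⟶ W) :
    coneLift f x e ≫ coneFst f n ≫ h = x ≫ h := by
  rw [← Category.assoc, coneLift_fst]

@[simp]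
lemma coneLift_snd {P : A} {n : ℤ} (x : P ⟶ X.X n) (e : P ⟶ E.X (n - 1)) :
    coneLift f x e ≫ coneSnd f n = e :=
  biprod.lift_snd _ _

@[simp]
lemma coneLift_snd_assoc {P : A} {n : ℤ} (x : P ⟶ X.X n) (e : P ⟶ E.X (n - 1)) {W : A}
    (h : E.X (n - 1) ⟶ W) :
    coneLift f x e ≫ coneSnd f n ≫ h = e ≫ h := by
  rw [← Category.assoc, coneLift_snd]

variable {f} in
lemma cone_hom_ext {P : A} {n : ℤ} {a b : P ⟶ (cone f).X n}
    (h₁ : a ≫ coneFst f n = b ≫ coneFst f n) (h₂ : a ≫ coneSnd f n = b ≫ coneSnd f n) : a = b :=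
  biprod.hom_ext (X := X.X n) (Y := E.X (n - 1)) a b h₁ h₂

lemma cone_d_fst (n : ℤ) : (cone f).d n (n - 1) ≫ coneFst f (n - 1) =
    coneFst f n ≫ X.d n (n - 1) - coneSnd f n ≫ f.f (n - 1) :=
  (congr_arg (· ≫ _) (ofPred_d _ _ _ n)).trans (biprod.lift_fst _ _)

lemma cone_d_fst_assoc (n : ℤ) {W : A} (h : X.X (n - 1) ⟶ W) :
    (cone f).d n (n - 1) ≫ coneFst f (n - 1) ≫ h =
      (coneFst f n ≫ X.d n (n - 1) - coneSnd f n ≫ f.f (n - 1)) ≫ h := by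
  rw [← Category.assoc, cone_d_fst]

lemma cone_d_snd (n : ℤ) : (cone f).d n (n - 1) ≫ coneSnd f (n - 1) =
    -(coneSnd f n ≫ E.d (n - 1) (n - 1 - 1)) :=
  (congr_arg (· ≫ _) (ofPred_d _ _ _ n)).trans (biprod.lift_snd _ _)

lemma cone_d_snd_assoc (n : ℤ) {W : A} (h : E.X (n - 1 - 1) ⟶ W) :
    (cone f).d n (n - 1) ≫ coneSnd f (n - 1) ≫ h =
      (-(coneSnd f n ≫ E.d (n - 1) (n - 1 - 1))) ≫ h := by
  rw [← Category.assoc, cone_d_snd]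

/-- This turns the lifting problems of `LiftsCycles` into cycles of the cone. -/
lemma coneLift_d_eq_zero {P : A} {n : ℤ} (x : P ⟶ X.X n) (e : P ⟶ E.X (n - 1))
    (h₁ : e ≫ E.d (n - 1) (n - 1 - 1) = 0) (h₂ : e ≫ f.f (n - 1) = x ≫ X.d n (n - 1)) :
    coneLift f x e ≫ (cone f).d n (n - 1) = 0 := by
  apply cone_hom_ext
  · simp [cone_d_fst, Preadditive.comp_sub, h₂]
  · simp [cone_d_snd, h₁]

section

variable {E' X' : ChainComplex A ℤ} {f} {f' : E' ⟶ X'} (a : E ⟶ E') (b : X ⟶ X')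
  (w : f ≫ b = a ≫ f')

/-- The map between mapping cones induced by a commutative square. -/
noncomputable def coneMap : cone f ⟶ cone f' :=
  homMk (fun n => coneLift f' (coneFst f n ≫ b.f n) (coneSnd f n ≫ a.f (n - 1)))
    (fun n => by
      have h : f.f (n - 1) ≫ b.f (n - 1) = a.f (n - 1) ≫ f'.f (n - 1) :=
        congr_arg (fun g => HomologicalComplex.Hom.f g (n - 1)) w
      apply cone_hom_ext
      · simp [cone_d_fst, cone_d_fst_assoc, Preadditive.comp_sub, Preadditive.sub_comp, h]
      · simp [cone_d_snd, cone_d_snd_assoc])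

@[simp]
lemma coneMap_f_fst (n : ℤ) : (coneMap a b w).f n ≫ coneFst f' n = coneFst f n ≫ b.f n :=
  coneLift_fst _ _ _

lemma coneMap_f_fst_assoc (n : ℤ) {W : A} (h : X'.X n ⟶ W) :
    (coneMap a b w).f n ≫ coneFst f' n ≫ h = (coneFst f n ≫ b.f n) ≫ h := by
  rw [← Category.assoc, coneMap_f_fst]

@[simp]
lemma coneMap_f_snd (n : ℤ) : (coneMap a b w).f n ≫ coneSnd f' n = coneSnd f n ≫ a.f (n - 1) :=
  coneLift_snd _ _ _

lemma coneMap_f_snd_assoc (n : ℤ) {W : A} (h : E'.X (n - 1) ⟶ W) :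
    (coneMap a b w).f n ≫ coneSnd f' n ≫ h = (coneSnd f n ≫ a.f (n - 1)) ≫ h := by
  rw [← Category.assoc, coneMap_f_snd]

end

end Cone

lemma coneMap_id {E X : ChainComplex A ℤ} (f : E ⟶ X) :
    coneMap (f := f) (𝟙 E) (𝟙 X) (by simp) = 𝟙 _ := by
  ext n
  apply cone_hom_ext <;> simp

lemma coneMap_comp {E X E' X' E'' X'' : ChainComplex A ℤ} {f : E ⟶ X} {f' : E' ⟶ X'}
    {f'' : E'' ⟶ X''} (a : E ⟶ E') (b : X ⟶ X') (w : f ≫ b = a ≫ f') (a' : E' ⟶ E'')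
    (b' : X' ⟶ X'') (w' : f' ≫ b' = a' ≫ f'') :
    coneMap (f := f) (f' := f'') (a ≫ a') (b ≫ b') (by
      rw [← Category.assoc, w, Category.assoc, w', Category.assoc]) =
      coneMap a b w ≫ coneMap a' b' w' := by
  ext n
  apply cone_hom_ext <;> simp [coneMap_f_fst_assoc, coneMap_f_snd_assoc]

/-! ### Attaching a complex along a map to a mapping cone -/

section Attach

variable {E X K : ChainComplex A ℤ} {f : E ⟶ X} (q : K ⟶ cone f)

/-- For a chain map to the cone, the second component anticommutes with the differentials, and the
first is a null-homotopy of its composite with `f`. -/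
lemma f_coneFst_d (n : ℤ) : q.f n ≫ coneFst f n ≫ X.d n (n - 1) =
    K.d n (n - 1) ≫ q.f (n - 1) ≫ coneFst f (n - 1) + q.f n ≫ coneSnd f n ≫ f.f (n - 1) := by
  rw [← q.comm_assoc, cone_d_fst, Preadditive.comp_sub, sub_add_cancel]

lemma f_coneSnd_d (n : ℤ) : q.f n ≫ coneSnd f n ≫ E.d (n - 1) (n - 1 - 1) =
    -(K.d n (n - 1) ≫ q.f (n - 1) ≫ coneSnd f (n - 1)) := by
  rw [← q.comm_assoc, cone_d_snd, Preadditive.comp_neg, neg_neg]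

/-- The extension of `K` by `E`, with `E n ⊞ K n` in degree `n`, that is classified by the
component `K n ⟶ E (n - 1)` of a map `q` from `K` to the mapping cone of `f : E ⟶ X`. -/
noncomputable def attach : ChainComplex A ℤ :=
  ofPred (fun n => E.X n ⊞ K.X n)
    (fun n => biprod.lift
      (biprod.fst ≫ E.d n (n - 1) + biprod.snd ≫ q.f n ≫ coneSnd f n)
      (biprod.snd ≫ K.d n (n - 1)))
    (fun n => by
      ext <;> simp [f_coneSnd_d])

/-- The first projection from the extension. -/
noncomputable def attachFst (n : ℤ) : (attach q).X n ⟶ E.X n :=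
  (biprod.fst : E.X n ⊞ K.X n ⟶ _)

/-- The second projection from the extension. -/
noncomputable def attachSnd (n : ℤ) : (attach q).X n ⟶ K.X n :=
  (biprod.snd : E.X n ⊞ K.X n ⟶ _)

/-- The map to the extension with given components. -/
noncomputable def attachLift {P : A} {n : ℤ} (e : P ⟶ E.X n) (c : P ⟶ K.X n) :
    P ⟶ (attach q).X n :=
  (biprod.lift e c : P ⟶ E.X n ⊞ K.X n)

@[simp]
lemma attachLift_fst {P : A} {n : ℤ} (e : P ⟶ E.X n) (c : P ⟶ K.X n) :
    attachLift q e c ≫ attachFst q n = e :=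
  biprod.lift_fst _ _

@[simp]
lemma attachLift_fst_assoc {P : A} {n : ℤ} (e : P ⟶ E.X n) (c : P ⟶ K.X n) {W : A} (h : E.X n ⟶ W) :
    attachLift q e c ≫ attachFst q n ≫ h = e ≫ h := by
  rw [← Category.assoc, attachLift_fst]

@[simp]
lemma attachLift_snd {P : A} {n : ℤ} (e : P ⟶ E.X n) (c : P ⟶ K.X n) :
    attachLift q e c ≫ attachSnd q n = c :=
  biprod.lift_snd _ _

@[simp]
lemma attachLift_snd_assoc {P : A} {n : ℤ} (e : P ⟶ E.X n) (c : P ⟶ K.X n) {W : A} (h : K.X n ⟶ W) :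
    attachLift q e c ≫ attachSnd q n ≫ h = c ≫ h := by
  rw [← Category.assoc, attachLift_snd]

variable {q} in
lemma attach_hom_ext {P : A} {n : ℤ} {a b : P ⟶ (attach q).X n}
    (h₁ : a ≫ attachFst q n = b ≫ attachFst q n)
    (h₂ : a ≫ attachSnd q n = b ≫ attachSnd q n) : a = b :=
  biprod.hom_ext (X := E.X n) (Y := K.X n) a b h₁ h₂

lemma attach_d_fst (n : ℤ) : (attach q).d n (n - 1) ≫ attachFst q (n - 1) =
    attachFst q n ≫ E.d n (n - 1) + attachSnd q n ≫ q.f n ≫ coneSnd f n :=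
  (congr_arg (· ≫ _) (ofPred_d _ _ _ n)).trans (biprod.lift_fst _ _)

lemma attach_d_fst_assoc (n : ℤ) {W : A} (h : E.X (n - 1) ⟶ W) :
    (attach q).d n (n - 1) ≫ attachFst q (n - 1) ≫ h =
      (attachFst q n ≫ E.d n (n - 1) + attachSnd q n ≫ q.f n ≫ coneSnd f n) ≫ h := by
  rw [← Category.assoc, attach_d_fst]

lemma attach_d_snd (n : ℤ) : (attach q).d n (n - 1) ≫ attachSnd q (n - 1) =
    attachSnd q n ≫ K.d n (n - 1) :=
  (congr_arg (· ≫ _) (ofPred_d _ _ _ n)).trans (biprod.lift_snd _ _)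

lemma attach_d_snd_assoc (n : ℤ) {W : A} (h : K.X (n - 1) ⟶ W) :
    (attach q).d n (n - 1) ≫ attachSnd q (n - 1) ≫ h = (attachSnd q n ≫ K.d n (n - 1)) ≫ h := by
  rw [← Category.assoc, attach_d_snd]

/-- The inclusion of `E` into the extension of `K` by `E`. -/
noncomputable def attachInl : E ⟶ attach q :=
  homMk (fun n => attachLift q (𝟙 _) 0) (fun n => by
    apply attach_hom_ext
    · simp [attach_d_fst]
    · simp [attach_d_snd])

@[simp]
lemma attachInl_f_fst (n : ℤ) : (attachInl q).f n ≫ attachFst q n = 𝟙 _ :=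
  attachLift_fst _ _ _

@[simp]
lemma attachInl_f_fst_assoc (n : ℤ) {W : A} (h : E.X n ⟶ W) :
    (attachInl q).f n ≫ attachFst q n ≫ h = h := by
  rw [← Category.assoc, attachInl_f_fst, Category.id_comp]

@[simp]
lemma attachInl_f_snd (n : ℤ) : (attachInl q).f n ≫ attachSnd q n = 0 :=
  attachLift_snd _ _ _

@[simp]
lemma attachInl_f_snd_assoc (n : ℤ) {W : A} (h : K.X n ⟶ W) :
    (attachInl q).f n ≫ attachSnd q n ≫ h = 0 := by
  rw [← Category.assoc, attachInl_f_snd, zero_comp]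

/-- The map from the extension to the target of `f`. -/
noncomputable def attachDesc : attach q ⟶ X :=
  homMk (fun n => attachFst q n ≫ f.f n + attachSnd q n ≫ q.f n ≫ coneFst f n) (fun n => by
    simp [attach_d_fst_assoc, attach_d_snd_assoc, f_coneFst_d]
    abel)

lemma attachDesc_f (n : ℤ) : (attachDesc q).f n =
    attachFst q n ≫ f.f n + attachSnd q n ≫ q.f n ≫ coneFst f n := rfl

@[simp]
lemma attachInl_desc : attachInl q ≫ attachDesc q = f := by
  ext n
  simp [attachDesc_f]

section

variable {q} {E' X' K' : ChainComplex A ℤ} {f' : E' ⟶ X'} {q' : K' ⟶ cone f'}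
    (a : E ⟶ E') (b : X ⟶ X') (w : f ≫ b = a ≫ f') (k : K ⟶ K') (h : q ≫ coneMap a b w = k ≫ q')

/-- The map between extensions induced by compatible maps. -/
noncomputable def attachMap : attach q ⟶ attach q' :=
  homMk (fun n => attachLift q' (attachFst q n ≫ a.f n) (attachSnd q n ≫ k.f n)) (fun n => by
    have h' := congr_arg (fun g => HomologicalComplex.Hom.f g n ≫ coneSnd f' n) h
    simp only [HomologicalComplex.comp_f, Category.assoc, coneMap_f_snd] at h'
    apply attach_hom_ext
    · simp [attach_d_fst, attach_d_fst_assoc, h']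
    · simp [attach_d_snd, attach_d_snd_assoc])

@[simp]
lemma attachMap_f_fst (n : ℤ) :
    (attachMap a b w k h).f n ≫ attachFst q' n = attachFst q n ≫ a.f n :=
  attachLift_fst _ _ _

lemma attachMap_f_fst_assoc (n : ℤ) {W : A} (g : E'.X n ⟶ W) :
    (attachMap a b w k h).f n ≫ attachFst q' n ≫ g = (attachFst q n ≫ a.f n) ≫ g := by
  rw [← Category.assoc, attachMap_f_fst]

@[simp]
lemma attachMap_f_snd (n : ℤ) :
    (attachMap a b w k h).f n ≫ attachSnd q' n = attachSnd q n ≫ k.f n :=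
  attachLift_snd _ _ _

lemma attachMap_f_snd_assoc (n : ℤ) {W : A} (g : K'.X n ⟶ W) :
    (attachMap a b w k h).f n ≫ attachSnd q' n ≫ g = (attachSnd q n ≫ k.f n) ≫ g := by
  rw [← Category.assoc, attachMap_f_snd]

lemma attachInl_map : attachInl q ≫ attachMap a b w k h = a ≫ attachInl q' := by
  ext n
  apply attach_hom_ext <;> simp

lemma attachMap_desc : attachMap a b w k h ≫ attachDesc q' = attachDesc q ≫ b := by
  ext n
  have h₁ := congr_arg (fun g => HomologicalComplex.Hom.f g n ≫ coneFst f' n) h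
  have h₂ : f.f n ≫ b.f n = a.f n ≫ f'.f n :=
    congr_arg (fun g => HomologicalComplex.Hom.f g n) w
  simp only [HomologicalComplex.comp_f, Category.assoc, coneMap_f_fst] at h₁
  simp [attachDesc_f, attachMap_f_fst_assoc, attachMap_f_snd_assoc, h₁, h₂]

lemma attachMap_eq_id (a : E ⟶ E) (b : X ⟶ X) (w : f ≫ b = a ≫ f) (k : K ⟶ K)
    (h : q ≫ coneMap a b w = k ≫ q) (ha : a = 𝟙 E) (hk : k = 𝟙 K) :
    attachMap a b w k h = 𝟙 _ := by
  subst ha hk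
  ext n
  apply attach_hom_ext <;> simp

lemma attachMap_eq_comp {E'' X'' K'' : ChainComplex A ℤ} {f'' : E'' ⟶ X''} {q'' : K'' ⟶ cone f''}
    (a' : E' ⟶ E'') (b' : X' ⟶ X'') (w' : f' ≫ b' = a' ≫ f'') (k' : K' ⟶ K'')
    (h' : q' ≫ coneMap a' b' w' = k' ≫ q'')
    (a'' : E ⟶ E'') (b'' : X ⟶ X'') (w'' : f ≫ b'' = a'' ≫ f'') (k'' : K ⟶ K'')
    (h'' : q ≫ coneMap a'' b'' w'' = k'' ≫ q'') (ha : a'' = a ≫ a') (hk : k'' = k ≫ k') :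
    attachMap a'' b'' w'' k'' h'' = attachMap a b w k h ≫ attachMap a' b' w' k' h' := by
  subst ha hk
  ext n
  apply attach_hom_ext <;> simp [attachMap_f_fst_assoc, attachMap_f_snd_assoc]

end

end Attach

/-! ### The factorization attached to an augmented endofunctor -/

section Factorization

variable {C : ChainComplex A ℤ ⥤ ChainComplex A ℤ} (ε : C ⟶ 𝟭 (ChainComplex A ℤ))

/-- The middle object of the factorization of `f : E ⟶ X` through the extension
of `C (cone f)` by `E`, functorially in `f`. -/
noncomputable def attachFunctor : Arrow (ChainComplex A ℤ) ⥤ ChainComplex A ℤ where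
  obj f := attach (ε.app (cone f.hom))
  map φ := attachMap φ.left φ.right φ.w.symm (C.map (coneMap φ.left φ.right φ.w.symm))
    (ε.naturality _).symm
  map_id f := attachMap_eq_id _ _ _ _ _ rfl
    ((congr_arg C.map (coneMap_id f.hom)).trans (C.map_id _))
  map_comp φ ψ := attachMap_eq_comp _ _ _ _ _ _ _ _ _ _ _ _ _ _ _ rfl
    ((congr_arg C.map (coneMap_comp _ _ φ.w.symm _ _ ψ.w.symm)).trans (C.map_comp _ _))

/-- The first map of the factorization. -/
noncomputable def attachFunctorInl : Arrow.leftFunc ⟶ attachFunctor ε where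
  app f := attachInl (ε.app (cone f.hom))
  naturality _ _ φ := (attachInl_map φ.left φ.right φ.w.symm
    (C.map (coneMap φ.left φ.right φ.w.symm)) (ε.naturality _).symm).symm

/-- The second map of the factorization. -/
noncomputable def attachFunctorDesc : attachFunctor ε ⟶ Arrow.rightFunc where
  app f := attachDesc (ε.app (cone f.hom))
  naturality _ _ φ := attachMap_desc φ.left φ.right φ.w.symm
    (C.map (coneMap φ.left φ.right φ.w.symm)) (ε.naturality _).symm

end Factorization

end ChainComplex

namespace ProjectiveClass

open ChainComplex

variable {A : Type u} [Category.{v} A] [Abelian A] (𝓟 : ProjectiveClass A)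

/-! ### Cofibrant complexes and cofibrations -/

lemma isCofibrant_iff (K : ChainComplex A ℤ) :
    𝓟.IsCofibrant K ↔ ∀ {W Z : ChainComplex A ℤ} (p : W ⟶ Z),
      (𝓟.fibrations ⊓ 𝓟.equivalences) p → ∀ g : K ⟶ Z, ∃ l : K ⟶ W, l ≫ p = g := by
  constructor
  · intro h W Z p hp g
    have := h p hp
    have sq : CommSq (0 : 0 ⟶ W) (0 : 0 ⟶ K) p g := ⟨by simp⟩
    exact ⟨sq.lift, sq.fac_right⟩
  · intro h W Z p hp
    refine ⟨fun {a g} sq => ?_⟩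
    obtain ⟨l, hl⟩ := h p hp g
    exact ⟨⟨⟨l, (isZero_zero _).eq_of_src _ _, hl⟩⟩⟩

/-- A lift of a map `K ⟶ cone p` to `cone (𝟙 W)` is what a filler for `attachInl` against `p`
amounts to; this trivial fibration lets cofibrancy of `K` provide it. -/
lemma liftsCycles_coneMap {P : A} {W Z : ChainComplex A ℤ} {p : W ⟶ Z} (hp : LiftsCycles P p) :
    LiftsCycles P (coneMap (f := 𝟙 W) (f' := p) (𝟙 W) p (by simp)) := by
  refine .of_pred fun n e x he hx => ?_
  have h₁ := congr_arg (· ≫ coneFst _ _) hx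
  have h₂ := congr_arg (· ≫ coneSnd _ _) hx
  have h₃ := congr_arg (· ≫ coneFst _ _) he
  simp only [Category.assoc, coneMap_f_fst, coneMap_f_snd, cone_d_fst, cone_d_snd,
    HomologicalComplex.id_f, Category.comp_id, Preadditive.comp_sub, Preadditive.comp_neg,
    zero_comp] at h₁ h₂ h₃
  -- In components, `e₁ + x₂` is a cycle of `W` over `d x₁`, and a lift of `x₁` that it bounds is
  -- the missing component.
  obtain ⟨w, hw₁, hw₂⟩ := hp n (n - 1) (n - 1 - 1) (by ring) (by ring)
    (e ≫ coneFst _ _ + x ≫ coneSnd _ _) (x ≫ coneFst _ _)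
    (by simpa [h₂, sub_eq_add_neg] using h₃) (by simp [h₁])
  refine ⟨coneLift _ w (x ≫ coneSnd _ _), ?_, ?_⟩
  · apply cone_hom_ext
    · simp [cone_d_fst, Preadditive.comp_sub, hw₁]
    · simp [cone_d_snd, h₂]
  · apply cone_hom_ext <;> simp [hw₂]

lemma cofibrations_attachInl {E X K : ChainComplex A ℤ} {f : E ⟶ X} (q : K ⟶ cone f)
    (hK : 𝓟.IsCofibrant K) : 𝓟.cofibrations (attachInl q) := by
  intro W Z p hp
  refine ⟨fun {u v} sq => ?_⟩
  have hsq (n : ℤ) : u.f n ≫ p.f n = (attachInl q).f n ≫ v.f n :=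
    congr_arg (fun g => HomologicalComplex.Hom.f g n) sq.w
  -- The inclusion of `K` is not a chain map; its defect is the twisting term of `attach q`. Hence
  -- `v` on `K`, together with `u` on that term, is a chain map to `cone p`.
  have hinr (n : ℤ) : K.d n (n - 1) ≫ attachLift q 0 (𝟙 (K.X (n - 1))) =
      attachLift q 0 (𝟙 (K.X n)) ≫ (attach q).d n (n - 1) -
        (q.f n ≫ coneSnd f n) ≫ (attachInl q).f (n - 1) := by
    apply attach_hom_ext
    · simp [Preadditive.sub_comp, attach_d_fst]
    · simp [Preadditive.sub_comp, attach_d_snd]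
  let g : K ⟶ cone p := homMk
    (fun n => coneLift p (attachLift q 0 (𝟙 (K.X n)) ≫ v.f n) (q.f n ≫ coneSnd f n ≫ u.f (n - 1)))
    (fun n => by
      apply cone_hom_ext
      · have := hinr n =≫ v.f (n - 1)
        simp only [Category.assoc, Preadditive.sub_comp, ← hsq, ← v.comm] at this
        simp [cone_d_fst, Preadditive.comp_sub, this]
      · have := f_coneSnd_d q n =≫ u.f (n - 1 - 1)
        simp only [Category.assoc, Preadditive.neg_comp] at this
        simp [cone_d_snd, this])
  obtain ⟨l, hl⟩ := (𝓟.isCofibrant_iff K).1 hK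
    (coneMap (f := 𝟙 W) (f' := p) (𝟙 W) p (by simp))
    ((𝓟.trivialFibrations_iff _).2 fun P hP =>
      liftsCycles_coneMap ((𝓟.trivialFibrations_iff p).1 hp P hP)) g
  have hl₁ (n : ℤ) : l.f n ≫ coneFst _ n ≫ p.f n = attachLift q 0 (𝟙 (K.X n)) ≫ v.f n := by
    have := congr_arg (fun g => HomologicalComplex.Hom.f g n ≫ coneFst _ _) hl
    simpa [g] using this
  have hl₂ (n : ℤ) : l.f n ≫ coneSnd _ n = q.f n ≫ coneSnd f n ≫ u.f (n - 1) := by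
    have := congr_arg (fun g => HomologicalComplex.Hom.f g n ≫ coneSnd _ _) hl
    simpa [g] using this
  have hl₃ (n : ℤ) : l.f n ≫ coneFst _ n ≫ W.d n (n - 1) =
      K.d n (n - 1) ≫ l.f (n - 1) ≫ coneFst _ (n - 1) + q.f n ≫ coneSnd f n ≫ u.f (n - 1) := by
    rw [f_coneFst_d, HomologicalComplex.id_f, Category.comp_id, hl₂]
  refine ⟨⟨⟨homMk (fun n => attachFst q n ≫ u.f n + attachSnd q n ≫ l.f n ≫ coneFst _ n)
    (fun n => ?_), ?_, ?_⟩⟩⟩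
  · simp [attach_d_fst_assoc, attach_d_snd_assoc, hl₃]
    abel
  · ext n
    simp
  · ext n
    have : v.f n = (attachFst q n ≫ (attachInl q).f n + attachSnd q n ≫ attachLift q 0 (𝟙 _)) ≫
        v.f n := by
      conv_lhs => rw [← Category.id_comp (v.f n)]
      congr 1
      apply attach_hom_ext <;> simp
    rw [this]
    simp [hl₁, hsq]

/-- For a problem `((e, c₀), x)`, the element `c₀` is a cycle of `K` over the boundary of `(x, e)`
in the cone. If `c` bounds `c₀` and lies over `(x, e)`, then `(0, c)` is a solution. -/
lemma trivialFibrations_attachDesc {E X K : ChainComplex A ℤ} {f : E ⟶ X} (q : K ⟶ cone f)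
    (hq : (𝓟.fibrations ⊓ 𝓟.equivalences) q) :
    (𝓟.fibrations ⊓ 𝓟.equivalences) (attachDesc q) := by
  rw [trivialFibrations_iff] at hq ⊢
  refine fun P hP => .of_pred fun n a x ha hx => ?_
  have h₁ := congr_arg (· ≫ attachFst _ _) ha
  have h₂ := congr_arg (· ≫ attachSnd _ _) ha
  simp only [Category.assoc, attach_d_fst, attach_d_snd, attachDesc_f, Preadditive.comp_add,
    zero_comp] at h₁ h₂ hx
  obtain ⟨c, hc₁, hc₂⟩ := hq P hP n (n - 1) (n - 1 - 1) (by ring) (by ring)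
    (a ≫ attachSnd q (n - 1)) (coneLift f x (a ≫ attachFst q (n - 1))) (by simpa using h₂) (by
      apply cone_hom_ext
      · simp [cone_d_fst, Preadditive.comp_sub, ← hx]
      · simpa [cone_d_snd, add_eq_zero_iff_eq_neg'] using h₁)
  refine ⟨attachLift q 0 c, ?_, ?_⟩
  · apply attach_hom_ext
    · simp [attach_d_fst, reassoc_of% hc₂]
    · simp [attach_d_snd, hc₁]
  · simp [attachDesc_f, reassoc_of% hc₂]

end ProjectiveClass

/-! ### Graded maps as chain maps to cones of identities, and the degreewise form of cofibrations.
-/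

namespace ChainComplex

variable {A : Type u} [Category.{v} A] [Abelian A]

/-- The inclusion of the target of `f` into the mapping cone of `f`. -/
noncomputable def coneInl {E X : ChainComplex A ℤ} (f : E ⟶ X) : X ⟶ cone f :=
  homMk (fun n => coneLift f (𝟙 _) 0) (fun n => by
    apply cone_hom_ext
    · simp [cone_d_fst]
    · simp [cone_d_snd])

@[simp]
lemma coneInl_f_fst {E X : ChainComplex A ℤ} (f : E ⟶ X) (n : ℤ) :
    (coneInl f).f n ≫ coneFst f n = 𝟙 _ :=
  coneLift_fst _ _ _

@[simp]
lemma coneInl_f_snd {E X : ChainComplex A ℤ} (f : E ⟶ X) (n : ℤ) :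
    (coneInl f).f n ≫ coneSnd f n = 0 :=
  coneLift_snd _ _ _

lemma coneInl_map {E X E' X' : ChainComplex A ℤ} {f : E ⟶ X} {f' : E' ⟶ X'} (a : E ⟶ E')
    (b : X ⟶ X') (w : f ≫ b = a ≫ f') : coneInl f ≫ coneMap a b w = b ≫ coneInl f' := by
  ext n
  apply cone_hom_ext
  · rw [HomologicalComplex.comp_f, Category.assoc, coneMap_f_fst, ← Category.assoc, coneInl_f_fst]
    simp
  · rw [HomologicalComplex.comp_f, Category.assoc, coneMap_f_snd, ← Category.assoc, coneInl_f_snd]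
    simp

/-- The chain map to the mapping cone of the identity of `S` given by a map of graded objects. -/
noncomputable def toConeId {Y S : ChainComplex A ℤ} (g : ∀ n, Y.X n ⟶ S.X n) : Y ⟶ cone (𝟙 S) :=
  homMk (fun n => coneLift _ (g n) (g n ≫ S.d n (n - 1) - Y.d n (n - 1) ≫ g (n - 1))) (fun n => by
    apply cone_hom_ext
    · simp [cone_d_fst, Preadditive.comp_sub]
    · simp [cone_d_snd, Preadditive.sub_comp, Preadditive.comp_sub])

@[simp]
lemma toConeId_f_fst {Y S : ChainComplex A ℤ} (g : ∀ n, Y.X n ⟶ S.X n) (n : ℤ) :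
    (toConeId g).f n ≫ coneFst _ n = g n :=
  coneLift_fst _ _ _

@[simp]
lemma toConeId_f_snd {Y S : ChainComplex A ℤ} (g : ∀ n, Y.X n ⟶ S.X n) (n : ℤ) :
    (toConeId g).f n ≫ coneSnd _ n = g n ≫ S.d n (n - 1) - Y.d n (n - 1) ≫ g (n - 1) :=
  coneLift_snd _ _ _

/-- The chain complex with the given objects and zero differentials. -/
noncomputable def ofGraded (S : ℤ → A) : ChainComplex A ℤ :=
  ofPred S (fun _ => 0) (fun _ => zero_comp)

@[simp]
lemma ofGraded_d (S : ℤ → A) (i j : ℤ) : (ofGraded S).d i j = 0 := by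
  by_cases h : j = i - 1
  · subst h
    exact ofPred_d _ _ _ _
  · exact (ofGraded S).shape _ _ (fun h' => h (by simp only [ComplexShape.down_Rel] at h'; omega))

/-- Both cones are contractible, so degreewise surjectivity suffices: the first component of the
lift is chosen, and the boundary equation forces the second. -/
lemma liftsCycles_coneMap_id {P : A} {S T : ChainComplex A ℤ} (q : S ⟶ T)
    (hq : ∀ n, IsEpicFor P (q.f n)) :
    LiftsCycles P (coneMap (f := 𝟙 S) (f' := 𝟙 T) q q (by simp)) := by
  refine .of_pred fun n e x he hx => ?_
  have h₁ := congr_arg (· ≫ coneFst _ _) hx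
  have h₃ := congr_arg (· ≫ coneFst _ _) he
  simp only [Category.assoc, coneMap_f_fst, cone_d_fst,
    HomologicalComplex.id_f, Category.comp_id, Preadditive.comp_sub, zero_comp] at h₁ h₃
  obtain ⟨y, hy⟩ := hq n (x ≫ coneFst _ _)
  have hy' : y ≫ q.f n = x ≫ coneFst _ _ := hy
  refine ⟨coneLift _ y (y ≫ S.d n (n - 1) - e ≫ coneFst _ _), ?_, ?_⟩
  · apply cone_hom_ext
    · simp [cone_d_fst, Preadditive.comp_sub]
    · simpa [cone_d_snd, Preadditive.sub_comp, sub_eq_zero] using h₃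
  · apply cone_hom_ext
    · simp [hy']
    · have h₄ : y ≫ S.d n (n - 1) ≫ q.f (n - 1) = x ≫ coneFst _ _ ≫ T.d n (n - 1) := by
        rw [← q.comm, reassoc_of% hy']
      simp [Preadditive.sub_comp, h₁, h₄]

end ChainComplex

namespace ProjectiveClass

open ChainComplex

variable {A : Type u} [Category.{v} A] [Abelian A] (𝓟 : ProjectiveClass A)

/-- Cofibrations have the degreewise left lifting property with respect to relative fibrations. -/
lemma exists_graded_lift {X Y S T : ChainComplex A ℤ} {i : X ⟶ Y} (hi : 𝓟.cofibrations i)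
    {q : S ⟶ T} (hq : 𝓟.fibrations q) (a : ∀ n, X.X n ⟶ S.X n) (b : ∀ n, Y.X n ⟶ T.X n)
    (h : ∀ n, a n ≫ q.f n = i.f n ≫ b n) :
    ∃ l : ∀ n, Y.X n ⟶ S.X n, ∀ n, i.f n ≫ l n = a n ∧ l n ≫ q.f n = b n := by
  have := hi (coneMap (f := 𝟙 S) (f' := 𝟙 T) q q (by simp))
    ((𝓟.trivialFibrations_iff _).2 fun P hP => liftsCycles_coneMap_id q (hq P hP))
  -- Through `toConeId`, graded maps to `S` become chain maps to `cone (𝟙 S)`, and the graded square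
  -- becomes a square of complexes.
  have sq : CommSq (toConeId a) i (coneMap (f := 𝟙 S) (f' := 𝟙 T) q q (by simp)) (toConeId b) := by
    refine ⟨?_⟩
    ext n
    apply cone_hom_ext
    · simp [reassoc_of% toConeId_f_fst a n, h]
    · have h₁ : a n ≫ S.d n (n - 1) ≫ q.f (n - 1) = i.f n ≫ b n ≫ T.d n (n - 1) := by
        rw [← q.comm, reassoc_of% h n]
      have h₂ : i.f n ≫ Y.d n (n - 1) ≫ b (n - 1) = X.d n (n - 1) ≫ i.f (n - 1) ≫ b (n - 1) :=
        i.comm_assoc _ _ _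
      simp [reassoc_of% toConeId_f_snd a n, Preadditive.sub_comp, Preadditive.comp_sub, h, h₁, h₂]
  refine ⟨fun n => sq.lift.f n ≫ coneFst _ n, fun n => ⟨?_, ?_⟩⟩
  · have := congr_arg (fun g => HomologicalComplex.Hom.f g n ≫ coneFst _ n) sq.fac_left
    simpa only [HomologicalComplex.comp_f, Category.assoc, toConeId_f_fst] using this
  · have := congr_arg (fun g => HomologicalComplex.Hom.f g n ≫ coneFst _ n) sq.fac_right
    simpa only [HomologicalComplex.comp_f, Category.assoc, toConeId_f_fst, coneMap_f_fst] using this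

/-- The identity of the graded object `X` is lifted against `X ⟶ 0`. -/
lemma exists_retraction_of_cofibrations {X Y : ChainComplex A ℤ} {i : X ⟶ Y}
    (hi : 𝓟.cofibrations i) (n : ℤ) : ∃ r : Y.X n ⟶ X.X n, i.f n ≫ r = 𝟙 _ := by
  obtain ⟨l, hl⟩ := 𝓟.exists_graded_lift hi (q := (0 : X ⟶ 0))
    (fun P _ n b => ⟨0, ((HomologicalComplex.eval A _ n).map_isZero
      (isZero_zero (ChainComplex A ℤ))).eq_of_tgt _ _⟩)
    (fun _ => 𝟙 _) (fun _ => 0) (by simp)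
  exact ⟨l n, (hl n).1⟩

/-- A relative epimorphism, repeated in all degrees with zero differentials, is a fibration. A
graded lift that vanishes on `X` descends to the cokernel. -/
lemma proj_cokernel_of_cofibrations {X Y : ChainComplex A ℤ} {i : X ⟶ Y}
    (hi : 𝓟.cofibrations i) (n : ℤ) : 𝓟.proj (cokernel (i.f n)) := by
  rw [𝓟.proj_iff]
  intro S T q hq b
  let q' : ofGraded (fun _ : ℤ => S) ⟶ ofGraded (fun _ => T) := homMk (fun _ => q)
    (fun n => by rw [ofGraded_d, ofGraded_d]; exact comp_zero.trans zero_comp.symm)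
  obtain ⟨l, hl⟩ := 𝓟.exists_graded_lift hi (q := q') (fun P hP _ => (𝓟.epi_iff q).1 hq P hP)
    (fun _ => 0) (fun m => if h : m = n then (Y.XIsoOfEq h).hom ≫ cokernel.π (i.f n) ≫ b else 0)
    (fun m => by
      split_ifs with h
      · subst h
        simp only [HomologicalComplex.XIsoOfEq_rfl, Iso.refl_hom, Category.id_comp, zero_comp]
        exact ((cokernel.condition_assoc _ _).trans zero_comp).symm
      · simp)
  refine ⟨cokernel.desc _ (l n) (hl n).1, ?_⟩
  have := (hl n).2
  rw [dif_pos rfl] at this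
  rw [HomologicalComplex.XIsoOfEq_rfl, Iso.refl_hom, Category.id_comp] at this
  rw [← cancel_epi (cokernel.π (i.f n))]
  exact (cokernel.π_desc_assoc _ _ _ _).trans this

lemma IsCofibrant.proj {X : ChainComplex A ℤ} (hX : 𝓟.IsCofibrant X) (n : ℤ) :
    𝓟.proj (X.X n) := by
  have h := 𝓟.proj_cokernel_of_cofibrations hX n
  rw [𝓟.proj_iff] at h ⊢
  intro S T q hq
  let r : Retract (X.X n) (cokernel (HomologicalComplex.Hom.f (0 : 0 ⟶ X) n)) :=
    { i := cokernel.π _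
      r := cokernel.desc _ (𝟙 _) (by simp)
      retract := by simp }
  exact isEpicFor_of_retract r (h q hq)

end ProjectiveClass

namespace ProjectiveClass

open ChainComplex

variable {A : Type u} [Category.{v} A] [Abelian A] (𝓟 : ProjectiveClass A)

/-! ### Properness -/

lemma isProperStructure : IsProperStructure 𝓟.equivalences 𝓟.fibrations 𝓟.cofibrations where
  right_proper {X' X Y' Y g' p' p g} sq hp hg := by
    rw [equivalences_iff] at hg ⊢
    intro P hP i j k hij hjk x' x hx' hx
    have hsq (n : ℤ) : IsPullback (g'.f n) (p'.f n) (p.f n) (g.f n) :=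
      sq.map (HomologicalComplex.eval A _ n)
    obtain ⟨y', y, hy', hy⟩ := hg P hP i j k hij hjk (x' ≫ p'.f j) (x ≫ p.f i)
      (by simp [reassoc_of% hx'])
      (by rw [Category.assoc, ← (hsq j).w, reassoc_of% hx]; simp)
    -- The correction `y` lifts along `p`; changing `x` by the boundary of the lift gives an element
    -- compatible with `y'`, hence one of the pullback.
    obtain ⟨x₁, hx₁⟩ := hp P hP (i + 1) y
    have hx₁' : x₁ ≫ p.f (i + 1) = y := hx₁
    refine ⟨(hsq i).lift (x + x₁ ≫ X.d (i + 1) i) y' (by simp [hy, ← hx₁']), x₁, ?_, ?_⟩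
    · apply (hsq j).hom_ext
      · rw [Category.assoc, ← g'.comm, (hsq i).lift_fst_assoc, hx]
        simp
      · rw [Category.assoc, ← p'.comm, (hsq i).lift_snd_assoc, hy']
    · rw [(hsq i).lift_fst]
  left_proper {X X' Y Y' g i i' g'} sq hi hg := by
    rw [equivalences_iff] at hg ⊢
    intro P hP a b c hab hbc y y' hy hy'
    have hsq (n : ℤ) : IsPushout (g.f n) (i.f n) (i'.f n) (g'.f n) :=
      sq.map (HomologicalComplex.eval A _ n)
    -- Only the degreewise splitting of `i` matters: it splits the pushout too, through `r'` onto
    -- `X'` and `s` into `Y`, with `r' ≫ i' + s ≫ g' = 1`.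
    choose r hr using 𝓟.exists_retraction_of_cofibrations hi
    let r' (n : ℤ) : Y'.X n ⟶ X'.X n :=
      (hsq n).desc (𝟙 _) (r n ≫ g.f n) (by simp [reassoc_of% hr n])
    let s (n : ℤ) : Y'.X n ⟶ Y.X n := (hsq n).desc 0 (𝟙 _ - r n ≫ i.f n)
      (by simp [Preadditive.comp_sub, reassoc_of% hr n])
    have hr'₁ (n : ℤ) : i'.f n ≫ r' n = 𝟙 _ := (hsq n).inl_desc _ _ _
    have hr'₂ (n : ℤ) : g'.f n ≫ r' n = r n ≫ g.f n := (hsq n).inr_desc _ _ _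
    have hs₁ (n : ℤ) : i'.f n ≫ s n = 0 := (hsq n).inl_desc _ _ _
    have hs₂ (n : ℤ) : g'.f n ≫ s n = 𝟙 _ - r n ≫ i.f n := (hsq n).inr_desc _ _ _
    have hid (n : ℤ) : r' n ≫ i'.f n + s n ≫ g'.f n = 𝟙 _ := by
      apply (hsq n).hom_ext
      · simp [reassoc_of% hr'₁ n, reassoc_of% hs₁ n]
      · simp [reassoc_of% hr'₂ n, reassoc_of% hs₂ n, Preadditive.sub_comp, (hsq n).w]
    have hy'' : y' = y' ≫ r' a ≫ i'.f a + y' ≫ s a ≫ g'.f a := by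
      rw [← Preadditive.comp_add, hid, Category.comp_id]
    have mono_i (n : ℤ) {u w : P ⟶ X.X n} (h : u ≫ i.f n = w ≫ i.f n) : u = w := by
      simpa [hr n] using h =≫ r n
    have mono_i' (n : ℤ) {u w : P ⟶ X'.X n} (h : u ≫ i'.f n = w ≫ i'.f n) : u = w := by
      simpa [hr'₁ n] using h =≫ r' n
    -- `y₀` is the part of the cycle `y` that lies in `X`
    let y₀ := y - y' ≫ s a ≫ Y.d a b
    have hy₀ : y₀ ≫ g'.f b = y' ≫ r' a ≫ X'.d a b ≫ i'.f b := by
      rw [Preadditive.sub_comp, hy', sub_eq_iff_eq_add]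
      conv_lhs => rw [hy'']
      simp
    have hy₀' : y₀ = y₀ ≫ r b ≫ i.f b := by
      have := hy₀ =≫ s b
      simpa [hs₁, hs₂, Preadditive.comp_sub, sub_eq_zero] using this
    have hy₀'' : y₀ ≫ Y.d b c = 0 := by simp [y₀, Preadditive.sub_comp, hy]
    obtain ⟨x₁, x₁', hx₁, hx₁'⟩ := hg P hP a b c hab hbc (y₀ ≫ r b) (y' ≫ r' a)
      (by
        apply mono_i
        rw [Category.assoc, Category.assoc, ← i.comm, ← Category.assoc, ← Category.assoc,
          Category.assoc y₀, ← hy₀', hy₀'', zero_comp])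
      (by
        apply mono_i'
        simp only [Category.assoc, (hsq b).w]
        rw [← hy₀]
        conv_rhs => rw [hy₀']
        simp only [Category.assoc])
    refine ⟨x₁ ≫ i.f a + y' ≫ s a, x₁' ≫ i'.f (a + 1), ?_, ?_⟩
    · rw [Preadditive.add_comp, Category.assoc, i.comm, reassoc_of% hx₁, ← hy₀']
      simp [y₀]
    · rw [Preadditive.add_comp, Category.assoc, ← (hsq a).w, reassoc_of% hx₁']
      conv_rhs => rw [hy'']
      simp
      abel

end ProjectiveClass

namespace ChainComplex

variable {A : Type u} [Category.{v} A] [Abelian A]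

/-! ### Path complexes -/

section Path

/-- The contractible path complex of `Z`, with `Z n ⊞ Z (n + 1)` in degree `n`. -/
noncomputable def path (Z : ChainComplex A ℤ) : ChainComplex A ℤ :=
  ofPred (fun n => Z.X n ⊞ Z.X (n + 1))
    (fun n => biprod.lift (biprod.fst ≫ Z.d n (n - 1))
      (biprod.fst ≫ (Z.XIsoOfEq (sub_add_cancel n 1).symm).hom -
        biprod.snd ≫ Z.d (n + 1) (n - 1 + 1)))
    (fun n => by
      ext <;> simp [Preadditive.comp_sub])

variable (Z : ChainComplex A ℤ)

/-- The first projection from the path complex. -/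
noncomputable def pathFst (n : ℤ) : (path Z).X n ⟶ Z.X n :=
  (biprod.fst : Z.X n ⊞ Z.X (n + 1) ⟶ _)

/-- The second projection from the path complex. -/
noncomputable def pathSnd (n : ℤ) : (path Z).X n ⟶ Z.X (n + 1) :=
  (biprod.snd : Z.X n ⊞ Z.X (n + 1) ⟶ _)

/-- The map to the path complex with given components. -/
noncomputable def pathPair {P : A} {n : ℤ} (a : P ⟶ Z.X n) (b : P ⟶ Z.X (n + 1)) :
    P ⟶ (path Z).X n :=
  (biprod.lift a b : P ⟶ Z.X n ⊞ Z.X (n + 1))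

@[simp]
lemma pathPair_fst {P : A} {n : ℤ} (a : P ⟶ Z.X n) (b : P ⟶ Z.X (n + 1)) :
    pathPair Z a b ≫ pathFst Z n = a :=
  biprod.lift_fst _ _

@[simp]
lemma pathPair_snd {P : A} {n : ℤ} (a : P ⟶ Z.X n) (b : P ⟶ Z.X (n + 1)) :
    pathPair Z a b ≫ pathSnd Z n = b :=
  biprod.lift_snd _ _

@[simp]
lemma pathPair_fst_assoc {P : A} {n : ℤ} (a : P ⟶ Z.X n) (b : P ⟶ Z.X (n + 1)) {W : A}
    (h : Z.X n ⟶ W) : pathPair Z a b ≫ pathFst Z n ≫ h = a ≫ h := by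
  rw [← Category.assoc, pathPair_fst]

@[simp]
lemma pathPair_snd_assoc {P : A} {n : ℤ} (a : P ⟶ Z.X n) (b : P ⟶ Z.X (n + 1)) {W : A}
    (h : Z.X (n + 1) ⟶ W) : pathPair Z a b ≫ pathSnd Z n ≫ h = b ≫ h := by
  rw [← Category.assoc, pathPair_snd]

variable {Z} in
lemma path_hom_ext {P : A} {n : ℤ} {a b : P ⟶ (path Z).X n}
    (h₁ : a ≫ pathFst Z n = b ≫ pathFst Z n) (h₂ : a ≫ pathSnd Z n = b ≫ pathSnd Z n) : a = b :=
  biprod.hom_ext (X := Z.X n) (Y := Z.X (n + 1)) a b h₁ h₂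

lemma path_d_fst (n : ℤ) : (path Z).d n (n - 1) ≫ pathFst Z (n - 1) =
    pathFst Z n ≫ Z.d n (n - 1) :=
  (congr_arg (· ≫ _) (ofPred_d _ _ _ n)).trans (biprod.lift_fst _ _)

lemma path_d_snd (n : ℤ) : (path Z).d n (n - 1) ≫ pathSnd Z (n - 1) =
    pathFst Z n ≫ (Z.XIsoOfEq (sub_add_cancel n 1).symm).hom -
      pathSnd Z n ≫ Z.d (n + 1) (n - 1 + 1) :=
  (congr_arg (· ≫ _) (ofPred_d _ _ _ n)).trans (biprod.lift_snd _ _)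

lemma path_d_fst_assoc (n : ℤ) {W : A} (h : Z.X (n - 1) ⟶ W) :
    (path Z).d n (n - 1) ≫ pathFst Z (n - 1) ≫ h = pathFst Z n ≫ Z.d n (n - 1) ≫ h := by
  rw [← Category.assoc, path_d_fst, Category.assoc]

lemma path_d_snd_assoc (n : ℤ) {W : A} (h : Z.X (n - 1 + 1) ⟶ W) :
    (path Z).d n (n - 1) ≫ pathSnd Z (n - 1) ≫ h =
      pathFst Z n ≫ (Z.XIsoOfEq (sub_add_cancel n 1).symm).hom ≫ h -
        pathSnd Z n ≫ Z.d (n + 1) (n - 1 + 1) ≫ h := by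
  rw [← Category.assoc, path_d_snd, Preadditive.sub_comp, Category.assoc, Category.assoc]

variable {Z}

/-- The chain map from the path complex given by a map of graded objects. -/
noncomputable def pathDesc {W : ChainComplex A ℤ} (g : ∀ n, Z.X n ⟶ W.X n) : path Z ⟶ W :=
  homMk (fun n => pathFst Z n ≫ g n +
      pathSnd Z n ≫ (g (n + 1) ≫ W.d (n + 1) n - Z.d (n + 1) n ≫ g n)) (fun n => by
    have h₁ {m : ℤ} (h : n = m) : (Z.XIsoOfEq h).hom ≫ g m ≫ W.d m (n - 1) =
        g n ≫ W.d n (n - 1) := by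
      subst h
      simp
    have h₂ {m : ℤ} (h : n = m) : Z.d (n + 1) m ≫ g m ≫ W.d m (n - 1) =
        Z.d (n + 1) n ≫ g n ≫ W.d n (n - 1) := by
      subst h
      rfl
    simp [path_d_fst_assoc, path_d_snd_assoc, Preadditive.sub_comp, Preadditive.comp_sub,
      h₁ (sub_add_cancel n 1).symm, h₂ (sub_add_cancel n 1).symm]
    abel)

lemma pathDesc_f {W : ChainComplex A ℤ} (g : ∀ n, Z.X n ⟶ W.X n) (n : ℤ) :
    (pathDesc g).f n = pathFst Z n ≫ g n +
      pathSnd Z n ≫ (g (n + 1) ≫ W.d (n + 1) n - Z.d (n + 1) n ≫ g n) := rfl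

lemma pathDesc_comp {W V : ChainComplex A ℤ} (g : ∀ n, Z.X n ⟶ W.X n) (p : W ⟶ V) :
    pathDesc g ≫ p = pathDesc (fun n => g n ≫ p.f n) := by
  ext n
  simp [pathDesc_f, Preadditive.sub_comp, Preadditive.comp_sub]

/-- Since `(0, z) = d (z, 0) - (d z, 0)`, a chain map is determined by its restriction to the first
summand. -/
lemma pathDesc_surjective {W : ChainComplex A ℤ} (k : path Z ⟶ W) :
    ∃ g : ∀ n, Z.X n ⟶ W.X n, k = pathDesc g := by
  refine ⟨fun n => pathPair Z (𝟙 _) 0 ≫ k.f n, ?_⟩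
  ext n
  have h (m : ℤ) (hm : m = n) : pathSnd Z n ≫ (pathPair Z (𝟙 _) 0 ≫ k.f (n + 1)) ≫ W.d (n + 1) m =
      pathSnd Z n ≫ (pathPair Z (Z.d (n + 1) m) (Z.XIsoOfEq (by rw [hm])).hom) ≫ k.f m := by
    obtain rfl : m = n + 1 - 1 := by rw [hm]; ring
    simp only [Category.assoc, k.comm]
    rw [← Category.assoc (pathPair Z (𝟙 _) 0)]
    congr 2
    apply path_hom_ext
    · simp [path_d_fst]
    · simp [path_d_snd, Preadditive.comp_sub]
  rw [pathDesc_f, Preadditive.comp_sub, h n rfl]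
  have h' : 𝟙 _ = pathFst Z n ≫ pathPair Z (𝟙 _) 0 +
      pathSnd Z n ≫ pathPair Z (Z.d (n + 1) n) (Z.XIsoOfEq rfl).hom -
      pathSnd Z n ≫ Z.d (n + 1) n ≫ pathPair Z (𝟙 _) 0 := by
    apply path_hom_ext <;> simp [Preadditive.sub_comp]
  conv_lhs => rw [← Category.id_comp (k.f n), h']
  simp [Preadditive.sub_comp, add_sub_assoc]

/-- The path complex, as a functor. -/
noncomputable def pathFunctor (A : Type u) [Category.{v} A] [Abelian A] :
    ChainComplex A ℤ ⥤ ChainComplex A ℤ where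
  obj Z := path Z
  map {Z W} φ := homMk (fun n => pathPair W (pathFst Z n ≫ φ.f n) (pathSnd Z n ≫ φ.f (n + 1)))
    (fun n => by
      apply path_hom_ext
      · simp [path_d_fst, path_d_fst_assoc]
      · simp [path_d_snd, path_d_snd_assoc, Preadditive.comp_sub,
          HomologicalComplex.XIsoOfEq_hom_naturality])
  map_id Z := by
    ext n
    apply path_hom_ext <;> simp
  map_comp φ ψ := by
    ext n
    apply path_hom_ext <;> simp

/-- The projection from the path complex. -/
noncomputable def pathπ (A : Type u) [Category.{v} A] [Abelian A] :
    pathFunctor A ⟶ 𝟭 (ChainComplex A ℤ) where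
  app Z := homMk (fun n => pathFst Z n) (fun n => (path_d_fst Z n).symm)
  naturality Z W φ := by
    ext n
    exact pathPair_fst W _ _

/-- For `c = (c₁, c₂)` the cycle condition contains `c₁ = d c₂`, so `c` is the boundary of `(c₂,
0)`. -/
lemma path_acyclic {P : A} {i : ℤ} (c : P ⟶ (path Z).X i) (hc : c ≫ (path Z).d i (i - 1) = 0) :
    ∃ c' : P ⟶ (path Z).X (i + 1), c' ≫ (path Z).d (i + 1) i = c := by
  have h₁ := congr_arg (· ≫ pathSnd _ _) hc
  simp only [Category.assoc, path_d_snd, Preadditive.comp_sub, zero_comp, sub_eq_zero] at h₁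
  have h₂ : c ≫ pathFst Z i = (c ≫ pathSnd Z i) ≫ Z.d (i + 1) i := by
    have := h₁ =≫ (Z.XIsoOfEq (sub_add_cancel i 1)).hom
    simpa using this
  have key (m : ℤ) (hm : m = i) : (pathPair Z (c ≫ pathSnd Z i) 0) ≫ (path Z).d (i + 1) m =
      pathPair Z ((c ≫ pathSnd Z i) ≫ Z.d (i + 1) m)
        (c ≫ pathSnd Z i ≫ (Z.XIsoOfEq (by rw [hm])).hom) := by
    obtain rfl : m = i + 1 - 1 := by rw [hm]; ring
    apply path_hom_ext
    · simp [path_d_fst]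
    · simp [path_d_snd, Preadditive.comp_sub]
  refine ⟨pathPair Z (c ≫ pathSnd Z i) 0, ?_⟩
  rw [key i rfl]
  apply path_hom_ext
  · simp [h₂]
  · simp

end Path

/-! ### The factorization attached to an augmented endofunctor by a direct sum -/

section Sum

variable {K : ChainComplex A ℤ ⥤ ChainComplex A ℤ} (κ : K ⟶ 𝟭 (ChainComplex A ℤ))

lemma comp_coneInl_naturality {f f' : Arrow (ChainComplex A ℤ)} (φ : f ⟶ f') :
    (κ.app f.right ≫ coneInl f.hom) ≫ coneMap φ.left φ.right φ.w.symm =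
      K.map φ.right ≫ κ.app f'.right ≫ coneInl f'.hom := by
  rw [Category.assoc, coneInl_map, ← Category.assoc, ← Category.assoc]
  exact (κ.naturality φ.right).symm =≫ _

/-- The middle object of the factorization of `f : E ⟶ X` through the direct sum of `E`
and `K X`, functorially in `f`. -/
noncomputable def sumFunctor : Arrow (ChainComplex A ℤ) ⥤ ChainComplex A ℤ where
  obj f := attach (κ.app f.right ≫ coneInl f.hom)
  map φ := attachMap φ.left φ.right φ.w.symm (K.map φ.right)
    (comp_coneInl_naturality κ φ)
  map_id _ := attachMap_eq_id _ _ _ _ _ rfl (K.map_id _)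
  map_comp _ _ := attachMap_eq_comp _ _ _ _ _ _ _ _ _ _ _ _ _ _ _ rfl (K.map_comp _ _)

/-- The first map of the factorization. -/
noncomputable def sumFunctorInl : Arrow.leftFunc ⟶ sumFunctor κ where
  app f := attachInl (κ.app f.right ≫ coneInl f.hom)
  naturality _ _ φ := (attachInl_map φ.left φ.right φ.w.symm (K.map φ.right)
    (comp_coneInl_naturality κ φ)).symm

/-- The second map of the factorization. -/
noncomputable def sumFunctorDesc : sumFunctor κ ⟶ Arrow.rightFunc where
  app f := attachDesc (κ.app f.right ≫ coneInl f.hom)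
  naturality _ _ φ := attachMap_desc φ.left φ.right φ.w.symm (K.map φ.right)
    (comp_coneInl_naturality κ φ)

end Sum

/-- The twisting term `coneInl f ≫ coneSnd f` vanishes, so the extension is the direct sum of `E`
and a complex acyclic on `P`-elements. -/
lemma coneExact_attachInl {P : A} {E X K : ChainComplex A ℤ} {f : E ⟶ X} (κ : K ⟶ X)
    (hK : ∀ (i : ℤ) (c : P ⟶ K.X i), c ≫ K.d i (i - 1) = 0 →
      ∃ c' : P ⟶ K.X (i + 1), c' ≫ K.d (i + 1) i = c) :
    ConeExact P (attachInl (κ ≫ coneInl f)) := by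
  intro i j k hij hjk e y he hy
  obtain rfl : j = i - 1 := by omega
  have h₁ := congr_arg (· ≫ attachFst _ _) hy
  have h₂ := congr_arg (· ≫ attachSnd _ _) hy
  simp only [Category.assoc, attachInl_f_fst, attachInl_f_snd, attach_d_fst, attach_d_snd,
    HomologicalComplex.comp_f, coneInl_f_snd, comp_zero, add_zero, Category.comp_id] at h₁ h₂
  obtain ⟨c, hc⟩ := hK i (y ≫ attachSnd _ i) (by rw [Category.assoc, ← h₂])
  have key (m : ℤ) (hm : m + 1 = i + 1) (y' : P ⟶ (attach (κ ≫ coneInl f)).X m) :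
      attachLift (κ ≫ coneInl f) 0 c ≫ (attach _).d (i + 1) m =
        attachLift _ 0 (c ≫ K.d (i + 1) m) := by
    obtain rfl : m = i + 1 - 1 := by omega
    apply attach_hom_ext
    · simp [attach_d_fst]
    · simp [attach_d_snd]
  refine ⟨y ≫ attachFst _ i, -attachLift _ 0 c, by rw [Category.assoc, ← h₁], ?_⟩
  rw [Preadditive.neg_comp, key i rfl y, hc]
  apply attach_hom_ext <;> simp

end ChainComplex

namespace ProjectiveClass

open ChainComplex

variable {A : Type u} [Category.{v} A] [Abelian A] (𝓟 : ProjectiveClass A)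

/-- The extension is a direct sum, and a chain map from `path Z` lifts as soon as the graded map
that defines it does. This is possible degree by degree, each `Z.X n` being a relative projective.
-/
lemma llp_fibrations_attachInl_path {E X Z : ChainComplex A ℤ} {f : E ⟶ X} (κ : path Z ⟶ X)
    (hZ : ∀ n, 𝓟.proj (Z.X n)) : 𝓟.fibrations.llp (attachInl (κ ≫ coneInl f)) := by
  intro W V p hp
  refine ⟨fun {u v} sq => ?_⟩
  let inr : path Z ⟶ attach (κ ≫ coneInl f) := homMk (fun n => attachLift _ 0 (𝟙 _)) (fun n => by
    apply attach_hom_ext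
    · simp [attach_d_fst]
    · simp [attach_d_snd])
  obtain ⟨g, hg⟩ := pathDesc_surjective (inr ≫ v)
  choose l hl using fun n => hp _ (hZ n) n (g n)
  have hsq (n : ℤ) : u.f n ≫ p.f n = (attachInl _).f n ≫ v.f n :=
    congr_arg (fun g => HomologicalComplex.Hom.f g n) sq.w
  have hl' : pathDesc l ≫ p = inr ≫ v := by
    rw [pathDesc_comp, hg]
    congr 1
    exact funext hl
  have hl'' (n : ℤ) : (pathDesc l).f n ≫ p.f n = attachLift _ 0 (𝟙 _) ≫ v.f n :=
    congr_arg (fun g => HomologicalComplex.Hom.f g n) hl'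
  refine ⟨⟨⟨homMk (fun n => attachFst _ n ≫ u.f n + attachSnd _ n ≫ (pathDesc l).f n)
    (fun n => ?_), ?_, ?_⟩⟩⟩
  · simp [attach_d_fst_assoc, attach_d_snd_assoc]
  · ext n
    simp
  · ext n
    have : v.f n = (attachFst _ n ≫ (attachInl _).f n + attachSnd _ n ≫ attachLift _ 0 (𝟙 _)) ≫
        v.f n := by
      conv_lhs => rw [← Category.id_comp (v.f n)]
      congr 1
      apply attach_hom_ext <;> simp
    rw [this]
    simp [hsq, hl'']

/-! ### The model structure -/

lemma fibrations_attachDesc {E X K : ChainComplex A ℤ} {f : E ⟶ X} (κ : K ⟶ X)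
    (hκ : 𝓟.fibrations κ) : 𝓟.fibrations (attachDesc (κ ≫ coneInl f)) := by
  intro P hP n x
  obtain ⟨c, hc⟩ := hκ P hP n x
  have hc' : c ≫ κ.f n = x := hc
  exact ⟨attachLift _ 0 c, by simp [attachDesc_f, hc']⟩

/-- A cofibrant replacement functor factors chain maps functorially into a cofibration followed
by a trivial fibration. -/
noncomputable def cofTrivialFibFactorization {Q : ChainComplex A ℤ ⥤ ChainComplex A ℤ}
    (q : Q ⟶ 𝟭 (ChainComplex A ℤ)) (hQ : ∀ X, 𝓟.IsCofibrant (Q.obj X))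
    (hq : ∀ X, (𝓟.fibrations ⊓ 𝓟.equivalences) (q.app X)) :
    𝓟.cofibrations.FunctorialFactorizationData (𝓟.fibrations ⊓ 𝓟.equivalences) where
  Z := attachFunctor q
  i := attachFunctorInl q
  p := attachFunctorDesc q
  fac := by
    ext f : 2
    exact attachInl_desc _
  hi f := 𝓟.cofibrations_attachInl _ (hQ _)
  hp f := 𝓟.trivialFibrations_attachDesc _ (hq _)

/-- A cofibrant replacement functor factors chain maps functorially into an equivalence with the
left lifting property for all fibrations, followed by a fibration. -/
noncomputable def trivialCofFibFactorization {Q : ChainComplex A ℤ ⥤ ChainComplex A ℤ}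
    (q : Q ⟶ 𝟭 (ChainComplex A ℤ)) (hQ : ∀ X, 𝓟.IsCofibrant (Q.obj X))
    (hq : ∀ X, 𝓟.fibrations (q.app X)) :
    (𝓟.fibrations.llp ⊓ 𝓟.equivalences).FunctorialFactorizationData 𝓟.fibrations :=
  -- The path complex is taken of `Q X` instead of `X` because cofibrant complexes have relatively
  -- projective terms.
  let κ : (Q ⋙ pathFunctor A) ⟶ 𝟭 (ChainComplex A ℤ) := Functor.whiskerLeft Q (pathπ A) ≫ q
  { Z := sumFunctor κ
    i := sumFunctorInl κ
    p := sumFunctorDesc κ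
    fac := by
      ext f : 2
      exact attachInl_desc (κ.app f.right ≫ coneInl f.hom)
    hi f := ⟨𝓟.llp_fibrations_attachInl_path (f := f.hom) (κ.app f.right)
        fun n => (hQ f.right).proj 𝓟 n,
      (𝓟.equivalences_iff _).2 fun P _ => coneExact_attachInl (f := f.hom) (κ.app f.right)
        fun i c hc => path_acyclic c hc⟩
    hp f := 𝓟.fibrations_attachDesc (f := f.hom) (κ.app f.right) fun P hP n x => by
      obtain ⟨c, hc⟩ := hq f.right P hP n x
      have hc' : c ≫ (q.app f.right).f n = x := hc
      refine ⟨pathPair _ c 0, ?_⟩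
      change pathPair _ c 0 ≫ pathFst _ n ≫ (q.app f.right).f n = x
      rw [pathPair_fst_assoc, hc'] }

lemma llp_fibrations_le : 𝓟.fibrations.llp ≤ 𝓟.cofibrations :=
  MorphismProperty.antitone_llp inf_le_left

end ProjectiveClass

namespace ProjectiveClass

open ChainComplex

variable {A : Type u} [Category.{v} A] [Abelian A] (𝓟 : ProjectiveClass A)

instance : 𝓟.equivalences.HasTwoOutOfThreeProperty where
  comp_mem f g hf hg P hP := by
    have := hf P hP
    have := hg P hP
    rw [Functor.map_comp]
    infer_instance
  of_postcomp f g hg hfg P hP := by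
    have := hg P hP
    have := hfg P hP
    rw [Functor.map_comp] at this
    exact quasiIso_of_comp_right _ ((elementsFunctor P).map g)
  of_precomp f g hf hfg P hP := by
    have := hf P hP
    have := hfg P hP
    rw [Functor.map_comp] at this
    exact quasiIso_of_comp_left ((elementsFunctor P).map f) _

instance : 𝓟.equivalences.IsStableUnderRetracts where
  of_retract h hg P hP :=
    MorphismProperty.of_retract (P := HomologicalComplex.quasiIso _ _)
      (h.map (elementsFunctor P)) (hg P hP)

instance : 𝓟.fibrations.IsStableUnderRetracts where
  of_retract {X Y Z W f g} h hg P hP n y := by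
    obtain ⟨x, hx⟩ := hg P hP n (y ≫ h.i.right.f n)
    have hx' : x ≫ g.f n = y ≫ h.i.right.f n := hx
    have h₁ : h.r.left.f n ≫ f.f n = g.f n ≫ h.r.right.f n :=
      congr_arg (fun φ => HomologicalComplex.Hom.f φ n) h.r.w
    have h₂ : h.i.right.f n ≫ h.r.right.f n = 𝟙 _ :=
      congr_arg (fun φ => HomologicalComplex.Hom.f φ n) h.retract_right
    refine ⟨x ≫ h.r.left.f n, ?_⟩
    change (x ≫ h.r.left.f n) ≫ f.f n = y
    rw [Category.assoc, h₁, reassoc_of% hx', h₂]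
    exact Category.comp_id y

instance : 𝓟.cofibrations.IsStableUnderRetracts :=
  MorphismProperty.llp_isStableUnderRetracts _

lemma formsModelCategory [HasLimits A] [HasColimits A]
    (h : 𝓟.HasFunctorialCofibrantReplacements) :
    FormsModelCategory 𝓟.equivalences 𝓟.fibrations 𝓟.cofibrations := by
  obtain ⟨Q, q, hq⟩ := h
  let F₁ := 𝓟.cofTrivialFibFactorization q (fun X => (hq X).1) (fun X => (hq X).2)
  let F₂ := 𝓟.trivialCofFibFactorization q (fun X => (hq X).1) (fun X => (hq X).2.1)
  -- Retract argument: by two-out-of-three the second factor of `i` is a trivial fibration, so `i`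
  -- is a retract of its first factor.
  have hllp : 𝓟.cofibrations ⊓ 𝓟.equivalences ≤ 𝓟.fibrations.llp := by
    rintro X Y i ⟨hi, hi'⟩
    let D := F₂.factorizationData i
    have hp : 𝓟.equivalences D.p :=
      MorphismProperty.of_precomp (W := 𝓟.equivalences) D.i D.p D.hi.2 (by rwa [D.fac])
    have : HasLiftingProperty i D.p := hi D.p ⟨D.hp, hp⟩
    exact MorphismProperty.of_retract (P := 𝓟.fibrations.llp)
      (RetractArrow.ofLeftLiftingProperty D.fac) D.hi.1
  have H₁ : 𝓟.cofibrations.HasFunctorialFactorization (𝓟.fibrations ⊓ 𝓟.equivalences) := ⟨⟨F₁⟩⟩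
  have H₂ : (𝓟.cofibrations ⊓ 𝓟.equivalences).HasFunctorialFactorization 𝓟.fibrations :=
    ⟨⟨F₂.ofLE (inf_le_inf_right _ 𝓟.llp_fibrations_le) le_rfl⟩⟩
  refine ⟨⟨fun J _ => inferInstance⟩, ⟨fun J _ => inferInstance⟩, ?_, H₂, H₁⟩
  let _ : CategoryWithFibrations (ChainComplex A ℤ) := ⟨𝓟.fibrations⟩
  let _ : CategoryWithCofibrations (ChainComplex A ℤ) := ⟨𝓟.cofibrations⟩
  let _ : CategoryWithWeakEquivalences (ChainComplex A ℤ) := ⟨𝓟.equivalences⟩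
  have H₁' : MorphismProperty.HasFactorization 𝓟.cofibrations (𝓟.fibrations ⊓ 𝓟.equivalences) :=
    inferInstance
  have H₂' : MorphismProperty.HasFactorization (𝓟.cofibrations ⊓ 𝓟.equivalences) 𝓟.fibrations :=
    inferInstance
  have : (HomotopicalAlgebra.weakEquivalences (ChainComplex A ℤ)).HasTwoOutOfThreeProperty :=
    inferInstanceAs 𝓟.equivalences.HasTwoOutOfThreeProperty
  have : MorphismProperty.IsWeakFactorizationSystem
      (HomotopicalAlgebra.cofibrations (ChainComplex A ℤ))
      (trivialFibrations (ChainComplex A ℤ)) :=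
    MorphismProperty.IsWeakFactorizationSystem.mk' 𝓟.cofibrations
      (𝓟.fibrations ⊓ 𝓟.equivalences) (fun i p hi hp => hi p hp)
  have : MorphismProperty.IsWeakFactorizationSystem
      (trivialCofibrations (ChainComplex A ℤ))
      (HomotopicalAlgebra.fibrations (ChainComplex A ℤ)) :=
    MorphismProperty.IsWeakFactorizationSystem.mk' (𝓟.cofibrations ⊓ 𝓟.equivalences)
      𝓟.fibrations (fun i p hi hp => hllp i hi p hp)
  exact ⟨ModelCategory.mk' _, rfl, rfl, rfl⟩

lemma hasFunctorialCofibrantReplacements_of_formsModelCategory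
    (h : FormsModelCategory 𝓟.equivalences 𝓟.fibrations 𝓟.cofibrations) :
    𝓟.HasFunctorialCofibrantReplacements := by
  obtain ⟨⟨F⟩⟩ := h.functorial_cof_trivialFib
  let G : ChainComplex A ℤ ⥤ Arrow (ChainComplex A ℤ) :=
    { obj X := Arrow.mk (0 : 0 ⟶ X)
      map φ := Arrow.homMk (𝟙 _) φ }
  refine ⟨G ⋙ F.Z, Functor.whiskerLeft G F.p, fun X => ⟨?_, F.hp (G.obj X)⟩⟩
  have e : (0 : 0 ⟶ F.Z.obj (G.obj X)) = F.i.app (G.obj X) :=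
    (isZero_zero (ChainComplex A ℤ)).eq_of_src _ _
  exact (congr_arg (fun i => 𝓟.cofibrations i) e).mpr (F.hi (G.obj X))

end ProjectiveClass

universe w

namespace ProjectiveClass

open ChainComplex

variable {A : Type u} [Category.{v} A] [Abelian A] (𝓟 : ProjectiveClass A)

/-! ### Transfinite iteration of the factorization -/

/-- An exhaustive well-ordered filtration of a complex `Q` over `X` by cofibrations, in which each
step attaches a complex along the augmentation `ε`. -/
structure AttachTower {C : ChainComplex A ℤ ⥤ ChainComplex A ℤ} (ε : C ⟶ 𝟭 (ChainComplex A ℤ))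
    (J : Type w) [LinearOrder J] [SuccOrder J] {Q X : ChainComplex A ℤ} (q : Q ⟶ X) where
  /-- the filtration -/
  F : J ⥤ ChainComplex A ℤ
  /-- the inclusions of the steps of the filtration -/
  ι : F ⟶ (Functor.const J).obj Q
  /-- the filtration is exhaustive -/
  isColimit : IsColimit (Cocone.mk Q ι)
  isWellOrderContinuous : F.IsWellOrderContinuous
  cofibrations_map {i j : J} (f : i ⟶ j) : 𝓟.cofibrations (F.map f)
  /-- the restrictions of `q` to the steps of the filtration -/
  aug (j : J) : F.obj j ⟶ X
  ι_comp (j : J) : ι.app j ≫ q = aug j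
  /-- each step is the extension attached to the previous one -/
  succIso (j : J) (hj : ¬ IsMax j) : F.obj (Order.succ j) ≅ attach (ε.app (cone (aug j)))
  map_succIso (j : J) (hj : ¬ IsMax j) :
    F.map (homOfLE (Order.le_succ j)) ≫ (succIso j hj).hom = attachInl _
  succIso_desc (j : J) (hj : ¬ IsMax j) :
    (succIso j hj).hom ≫ attachDesc _ = aug (Order.succ j)

section

variable {C : ChainComplex A ℤ ⥤ ChainComplex A ℤ} (ε : C ⟶ 𝟭 (ChainComplex A ℤ))

/-- An augmented endofunctor, as a functor to arrows. -/
def overToArrow (p : Over (𝟭 (ChainComplex A ℤ))) :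
    ChainComplex A ℤ ⥤ Arrow (ChainComplex A ℤ) where
  obj X := Arrow.mk (p.hom.app X)
  map φ := Arrow.homMk (p.left.map φ) φ (p.hom.naturality φ)

/-- The successor structure that attaches `C (cone p)` to an endofunctor augmented by `p`. -/
noncomputable def attachSuccStruct : SmallObject.SuccStruct (Over (𝟭 (ChainComplex A ℤ))) where
  X₀ := Over.mk (Y := (Functor.const _).obj 0) { app _ := 0 }
  succ p := Over.mk (Y := overToArrow p ⋙ attachFunctor ε)
    { app X := attachDesc (ε.app (cone (p.hom.app X)))
      naturality _ _ φ := (attachFunctorDesc ε).naturality ((overToArrow p).map φ) }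
  toSucc p := Over.homMk
    { app X := attachInl (ε.app (cone (p.hom.app X)))
      naturality _ _ φ := (attachFunctorInl ε).naturality ((overToArrow p).map φ) } (by
      ext X : 2
      exact attachInl_desc _)

variable (J : Type w) [LinearOrder J] [OrderBot J] [SuccOrder J] [WellFoundedLT J]

/-- The evaluation of augmented endofunctors at a complex. -/
abbrev overEval (X : ChainComplex A ℤ) :
    Over (𝟭 (ChainComplex A ℤ)) ⥤ ChainComplex A ℤ :=
  Over.forget _ ⋙ (evaluation _ _).obj X

/-- Iterating among endofunctors over the identity makes the tower functorial and carries the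
augmentation along. Evaluation at `X` preserves the colimits involved and gives a transfinite
composition of cofibrations starting at `0`. -/
lemma exists_attachTower [HasColimitsOfSize.{w, w} A] (hC : ∀ Z, 𝓟.IsCofibrant (C.obj Z)) :
    ∃ (Q : ChainComplex A ℤ ⥤ ChainComplex A ℤ) (q : Q ⟶ 𝟭 (ChainComplex A ℤ)),
      ∀ X, 𝓟.IsCofibrant (Q.obj X) ∧ Nonempty (𝓟.AttachTower ε J (q.app X)) := by
  have : HasColimitsOfSize.{w, w} (Over (𝟭 (ChainComplex A ℤ))) := ⟨fun _ _ => inferInstance⟩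
  let Φ := attachSuccStruct ε
  refine ⟨(Φ.iteration J).left, (Φ.iteration J).hom, fun X => ?_⟩
  have : PreservesWellOrderContinuousOfShape J (overEval X) := ⟨fun _ _ => inferInstance⟩
  have hΦ : Φ.prop ≤ 𝓟.cofibrations.inverseImage (overEval X) := by
    rintro _ _ _ ⟨p⟩
    exact 𝓟.cofibrations_attachInl _ (hC _)
  have : 𝓟.cofibrations.IsStableUnderTransfiniteComposition.{w} :=
    inferInstanceAs (MorphismProperty.llp _).IsStableUnderTransfiniteComposition
  let T := ((Φ.transfiniteCompositionOfShapeιIteration J).ofLE hΦ).map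
  refine ⟨?_, ⟨?_⟩⟩
  · have h : 𝓟.cofibrations ((overEval X).map (Φ.ιIteration J)) :=
      MorphismProperty.transfiniteCompositionsOfShape_le _ _ _ T.mem
    have e : (0 : 0 ⟶ (overEval X).obj (Φ.iteration J)) = (overEval X).map (Φ.ιIteration J) :=
      (isZero_zero (ChainComplex A ℤ)).eq_of_src _ _
    exact (congr_arg (fun i => 𝓟.cofibrations i) e).mpr h
  · exact
      { F := Φ.iterationFunctor J ⋙ overEval X
        ι := ((overEval X).mapCocone (Φ.iterationCocone J)).ι
        isColimit := isColimitOfPreserves (overEval X) (Φ.isColimitIterationCocone J)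
        isWellOrderContinuous := T.isWellOrderContinuous
        cofibrations_map := fun f => T.mem_map f
        aug := fun j => ((Φ.iterationFunctor J).obj j).hom.app X
        ι_comp := fun j =>
          congr_arg (fun g => NatTrans.app g X) (Over.w ((Φ.iterationCocone J).ι.app j))
        succIso := fun j hj => (overEval X).mapIso (Φ.iterationFunctorObjSuccIso j hj)
        map_succIso := fun j hj => by
          have h := Φ.iterationFunctor_map_succ j hj
          rw [Iso.eq_comp_inv] at h
          exact congr_arg (fun g => NatTrans.app (CommaMorphism.left g) X) h
        succIso_desc := fun j hj =>
          congr_arg (fun g => NatTrans.app g X) (Over.w (Φ.iterationFunctorObjSuccIso j hj).hom) }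

end

end ProjectiveClass

/-! ### Lifting of cycles as a property of maps of `A`, and covers of cycles. -/

namespace ChainComplex

variable {A : Type u} [Category.{v} A]

section

variable [Abelian A]

/-- The object of pairs `(e, x)` as in `LiftsCycles`. -/
noncomputable def cyclePairs {E X : ChainComplex A ℤ} (f : E ⟶ X) (n : ℤ) : A :=
  pullback (kernel.ι (E.d (n - 1) (n - 1 - 1)) ≫ f.f (n - 1)) (X.d n (n - 1))

section CyclePairs

variable {E X : ChainComplex A ℤ} (f : E ⟶ X) (n : ℤ)

/-- The cycle of a pair. -/
noncomputable def cyclePairsFst : cyclePairs f n ⟶ E.X (n - 1) :=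
  pullback.fst (kernel.ι (E.d (n - 1) (n - 1 - 1)) ≫ f.f (n - 1)) (X.d n (n - 1)) ≫ kernel.ι _

/-- The bounding element of a pair. -/
noncomputable def cyclePairsSnd : cyclePairs f n ⟶ X.X n :=
  pullback.snd (kernel.ι (E.d (n - 1) (n - 1 - 1)) ≫ f.f (n - 1)) (X.d n (n - 1))

@[simp]
lemma cyclePairsFst_d : cyclePairsFst f n ≫ E.d (n - 1) (n - 1 - 1) = 0 :=
  (Category.assoc _ _ _).trans ((congr_arg _ (kernel.condition _)).trans comp_zero)

lemma cyclePairsFst_f : cyclePairsFst f n ≫ f.f (n - 1) = cyclePairsSnd f n ≫ X.d n (n - 1) :=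
  (Category.assoc _ _ _).trans pullback.condition

variable {f n} in
lemma cyclePairs_hom_ext {P : A} {a b : P ⟶ cyclePairs f n}
    (h₁ : a ≫ cyclePairsFst f n = b ≫ cyclePairsFst f n)
    (h₂ : a ≫ cyclePairsSnd f n = b ≫ cyclePairsSnd f n) : a = b := by
  refine pullback.hom_ext ((cancel_mono (kernel.ι _)).1 ?_) h₂
  exact (Category.assoc _ _ _).trans (h₁.trans (Category.assoc _ _ _).symm)

lemma exists_cyclePairs_lift {P : A} (e : P ⟶ E.X (n - 1)) (x : P ⟶ X.X n)
    (he : e ≫ E.d (n - 1) (n - 1 - 1) = 0) (hx : e ≫ f.f (n - 1) = x ≫ X.d n (n - 1)) :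
    ∃ l : P ⟶ cyclePairs f n, l ≫ cyclePairsFst f n = e ∧ l ≫ cyclePairsSnd f n = x := by
  refine ⟨pullback.lift (kernel.lift _ e he) x (by simp [hx]), ?_, pullback.lift_snd _ _ _⟩
  exact (pullback.lift_fst_assoc _ _ _ _).trans (kernel.lift_ι _ _ _)

/-- The map that sends an element `e` to the pair `(d e, f e)`. -/
noncomputable def toCyclePairs : E.X n ⟶ cyclePairs f n :=
  (exists_cyclePairs_lift f n (E.d n (n - 1)) (f.f n) (E.d_comp_d _ _ _) (f.comm _ _).symm).choose

@[simp]
lemma toCyclePairs_fst : toCyclePairs f n ≫ cyclePairsFst f n = E.d n (n - 1) :=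
  (exists_cyclePairs_lift f n (E.d n (n - 1)) (f.f n) (E.d_comp_d _ _ _)
    (f.comm _ _).symm).choose_spec.1

@[simp]
lemma toCyclePairs_snd : toCyclePairs f n ≫ cyclePairsSnd f n = f.f n :=
  (exists_cyclePairs_lift f n (E.d n (n - 1)) (f.f n) (E.d_comp_d _ _ _)
    (f.comm _ _).symm).choose_spec.2

/-- In this form, lifting cycles passes from the small projectives to all relative projectives. -/
lemma liftsCycles_iff {P : A} : LiftsCycles P f ↔ ∀ n, IsEpicFor P (toCyclePairs f n) := by
  constructor
  · intro h n b
    obtain ⟨e, h₁, h₂⟩ := h n (n - 1) (n - 1 - 1) (by ring) (by ring)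
      (b ≫ cyclePairsFst f n) (b ≫ cyclePairsSnd f n) (by simp) (by simp [cyclePairsFst_f])
    exact ⟨e, cyclePairs_hom_ext (by simp [h₁]) (by simp [h₂])⟩
  · intro h
    refine .of_pred fun n e x he hx => ?_
    obtain ⟨l, hl₁, hl₂⟩ := exists_cyclePairs_lift f n e x he hx
    obtain ⟨e', he'⟩ := h n l
    have h' : e' ≫ toCyclePairs f n = l := he'
    refine ⟨e', ?_, ?_⟩
    · rw [← hl₁, ← h', Category.assoc, toCyclePairs_fst]
    · rw [← hl₂, ← h', Category.assoc, toCyclePairs_snd]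

end CyclePairs

lemma exists_attach_lift {P : A} {E X K : ChainComplex A ℤ} {f : E ⟶ X} (q : K ⟶ cone f) {n : ℤ}
    (e : P ⟶ E.X (n - 1)) (x : P ⟶ X.X n) (c : P ⟶ K.X n) (hc : c ≫ K.d n (n - 1) = 0)
    (hq : c ≫ q.f n = coneLift f x e) : ∃ e' : P ⟶ (attach q).X n,
      e' ≫ (attach q).d n (n - 1) = e ≫ (attachInl q).f (n - 1) ∧
        e' ≫ (attachDesc q).f n = x := by
  refine ⟨attachLift q 0 c, ?_, ?_⟩
  · apply attach_hom_ext
    · simp [attach_d_fst, reassoc_of% hq]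
    · simp [attach_d_snd, hc]
  · simp [attachDesc_f, reassoc_of% hq]

/-! ### Covering the cycles of a complex -/

section

variable {R : A ⥤ A} (π : R ⟶ 𝟭 A)

/-- The complex with zero differential obtained by applying a functor to the cycles. -/
noncomputable def cyclesCover (R : A ⥤ A) : ChainComplex A ℤ ⥤ ChainComplex A ℤ where
  obj X := ofGraded (fun n => R.obj (X.cycles n))
  map φ := homMk (fun n => R.map (HomologicalComplex.cyclesMap φ n)) (fun n => by
    rw [ofGraded_d, ofGraded_d]
    exact comp_zero.trans zero_comp.symm)
  map_id X := by
    ext n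
    exact (congr_arg R.map (HomologicalComplex.cyclesMap_id X n)).trans (R.map_id _)
  map_comp φ ψ := by
    ext n
    exact (congr_arg R.map (HomologicalComplex.cyclesMap_comp φ ψ n)).trans (R.map_comp _ _)

/-- The augmentation of `cyclesCover`. -/
noncomputable def cyclesCoverπ : cyclesCover R ⟶ 𝟭 (ChainComplex A ℤ) where
  app X := homMk (fun n => π.app (X.cycles n) ≫ X.iCycles n) (fun n => by
    have h₁ : ((cyclesCover R).obj X).d n (n - 1) = 0 := ofGraded_d _ _ _
    have h₂ : (π.app (X.cycles n) ≫ X.iCycles n) ≫ X.d n (n - 1) = 0 := by simp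
    rw [h₁, zero_comp]
    exact h₂)
  naturality X Y φ := by
    ext n
    have h₁ := π.naturality (HomologicalComplex.cyclesMap φ n)
    have h₂ := HomologicalComplex.cyclesMap_i φ n
    change R.map (HomologicalComplex.cyclesMap φ n) ≫ π.app (Y.cycles n) ≫ Y.iCycles n =
      (π.app (X.cycles n) ≫ X.iCycles n) ≫ φ.f n
    rw [reassoc_of% h₁, Category.assoc, ← h₂]

lemma exists_cyclesCoverπ_lift (X : ChainComplex A ℤ) {P : A} {n : ℤ}
    (hπ : IsEpicFor P (π.app (X.cycles n))) (x : P ⟶ X.X n) (hx : x ≫ X.d n (n - 1) = 0) :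
    ∃ c : P ⟶ ((cyclesCover R).obj X).X n, c ≫ ((cyclesCoverπ π).app X).f n = x := by
  obtain ⟨c, hc⟩ := hπ (X.liftCycles x (n - 1) (by simp) hx)
  have hc' : c ≫ π.app (X.cycles n) = _ := hc
  refine ⟨c, ?_⟩
  change c ≫ π.app (X.cycles n) ≫ X.iCycles n = x
  simp [reassoc_of% hc']

end

end

end ChainComplex

/-! ### Case B: enough small projectives. -/

namespace ProjectiveClass

open ChainComplex

variable {A : Type u} [Category.{v} A] [Abelian A] (𝓟 : ProjectiveClass A)

/-- Each `g.f n` is a cycle, and `LiftsCycles` with `e = 0` lifts it to a cycle. -/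
lemma isCofibrant_ofGraded {S : ℤ → A} (hS : ∀ n, 𝓟.proj (S n)) : 𝓟.IsCofibrant (ofGraded S) := by
  rw [isCofibrant_iff]
  intro W Z p hp g
  rw [trivialFibrations_iff] at hp
  have h (n : ℤ) : ∃ w : (ofGraded S).X n ⟶ W.X n, w ≫ W.d n (n - 1) = 0 ∧ w ≫ p.f n = g.f n :=
    hp ((ofGraded S).X n) (hS n) n (n - 1) (n - 1 - 1) (by ring) (by ring) 0 (g.f n) (by simp)
      (by rw [g.comm, ofGraded_d, zero_comp, zero_comp])
  choose w h₁ h₂ using h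
  refine ⟨homMk w (fun n => (h₁ n).trans ?_), ?_⟩
  · rw [ofGraded_d, zero_comp]
  · ext n
    exact h₂ n

/-- In an attached tower of long enough length, small objects lift cycles. -/
lemma AttachTower.liftsCycles [HasColimits A] {R : A ⥤ A} {π : R ⟶ 𝟭 A} {J : Type v}
    [LinearOrder J] [SuccOrder J] [OrderBot J] [WellFoundedLT J] [NoMaxOrder J]
    {Q X : ChainComplex A ℤ} {q : Q ⟶ X} (T : 𝓟.AttachTower (cyclesCoverπ π) J q)
    {κ : Cardinal.{v}} (hJ : κ < Order.cof J) {P : A} (hπ : ∀ M, IsEpicFor P (π.app M))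
    (hP : IsSmallRelativeTo κ 𝓟.splitMonosWithProjCokernel P) : LiftsCycles P q := by
  have := T.isWellOrderContinuous
  have hF (n : ℤ) : (T.F ⋙ HomologicalComplex.eval A _ n).IsWellOrderContinuous := by
    have : PreservesWellOrderContinuousOfShape J
      (HomologicalComplex.eval A (ComplexShape.down ℤ) n) := ⟨fun _ _ => inferInstance⟩
    infer_instance
  have hpres (n : ℤ) : PreservesColimit (T.F ⋙ HomologicalComplex.eval A _ n)
      (coyoneda.obj (op P)) := by
    refine hP J hJ _ (hF n) fun h => ⟨?_, 𝓟.proj_cokernel_of_cofibrations (T.cofibrations_map h) n⟩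
    obtain ⟨r, hr⟩ := 𝓟.exists_retraction_of_cofibrations (T.cofibrations_map h) n
    exact ⟨⟨⟨r, hr⟩⟩⟩
  have hcolim (n : ℤ) : IsColimit ((coyoneda.obj (op P)).mapCocone
      ((HomologicalComplex.eval A _ n).mapCocone (Cocone.mk Q T.ι))) :=
    isColimitOfPreserves _ (isColimitOfPreserves _ T.isColimit)
  refine .of_pred fun n e x he hx => ?_
  have hι {i j : J} (h : i ≤ j) (m : ℤ) :
      (T.F.map (homOfLE h)).f m ≫ (T.ι.app j).f m = (T.ι.app i).f m :=
    congr_arg (fun g => HomologicalComplex.Hom.f g m)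
      ((T.ι.naturality (homOfLE h)).trans (Category.comp_id _))
  have haug (j : J) (m : ℤ) : (T.ι.app j).f m ≫ q.f m = (T.aug j).f m :=
    congr_arg (fun g => HomologicalComplex.Hom.f g m) (T.ι_comp j)
  obtain ⟨j, e₀, he₀⟩ : ∃ (j : J) (e₀ : P ⟶ (T.F.obj j).X (n - 1)),
      e₀ ≫ (T.ι.app j).f (n - 1) = e := Types.jointly_surjective_of_isColimit (hcolim (n - 1)) e
  -- The representative `e₀` need not be a cycle at its own stage, but its boundary dies in the
  -- colimit, hence at a later stage.
  obtain ⟨k, f, hk⟩ : ∃ (k : J) (f : j ≤ k), (e₀ ≫ (T.F.obj j).d (n - 1) (n - 1 - 1)) ≫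
      (T.F.map (homOfLE f)).f (n - 1 - 1) = 0 ≫ (T.F.map (homOfLE f)).f (n - 1 - 1) := by
    suffices h : _ by
      obtain ⟨k, f, hk⟩ := (Types.FilteredColimit.isColimit_eq_iff' (hcolim (n - 1 - 1))
        (e₀ ≫ (T.F.obj j).d (n - 1) (n - 1 - 1)) (0 : P ⟶ (T.F.obj j).X (n - 1 - 1))).1 h
      exact ⟨k, f.le, hk⟩
    change (e₀ ≫ (T.F.obj j).d (n - 1) (n - 1 - 1)) ≫ (T.ι.app j).f (n - 1 - 1) =
      0 ≫ (T.ι.app j).f (n - 1 - 1)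
    rw [zero_comp, Category.assoc, ← HomologicalComplex.Hom.comm, reassoc_of% he₀]
    exact he
  have hk₁ := not_isMax k
  have h₁ : (e₀ ≫ (T.F.map (homOfLE f)).f (n - 1)) ≫ (T.F.obj k).d (n - 1) (n - 1 - 1) = 0 := by
    rw [Category.assoc, HomologicalComplex.Hom.comm, ← Category.assoc, hk, zero_comp]
  have h₂ : (e₀ ≫ (T.F.map (homOfLE f)).f (n - 1)) ≫ (T.aug k).f (n - 1) =
      x ≫ X.d n (n - 1) := by
    rw [← hx, ← he₀, Category.assoc, Category.assoc, ← haug k, reassoc_of% hι f]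
  -- The pair is now a cycle of the cone at stage `k`; the cover attached next contains an element
  -- over it.
  obtain ⟨c, hc⟩ := exists_cyclesCoverπ_lift π (cone (T.aug k)) (hπ _) _
    (coneLift_d_eq_zero (T.aug k) x _ h₁ h₂)
  obtain ⟨e', h₃, h₄⟩ := exists_attach_lift _ _ x c (by
    have : ((cyclesCover R).obj (cone (T.aug k))).d n (n - 1) = 0 := ofGraded_d _ _ _
    rw [this, comp_zero]) hc
  have h₅ (m : ℤ) : (attachInl ((cyclesCoverπ π).app (cone (T.aug k)))).f m ≫
      (T.succIso k hk₁).inv.f m = (T.F.map (homOfLE (Order.le_succ k))).f m :=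
    congr_arg (fun g => HomologicalComplex.Hom.f g m)
      ((Iso.eq_comp_inv _).2 (T.map_succIso k hk₁)).symm
  have h₆ : (attachDesc ((cyclesCoverπ π).app (cone (T.aug k)))).f n =
      (T.succIso k hk₁).inv.f n ≫ (T.aug (Order.succ k)).f n :=
    congr_arg (fun g => HomologicalComplex.Hom.f g n)
      ((Iso.eq_inv_comp _).2 (T.succIso_desc k hk₁))
  refine ⟨e' ≫ (T.succIso k hk₁).inv.f n ≫ (T.ι.app (Order.succ k)).f n, ?_, ?_⟩
  · have := (T.ι.app (Order.succ k)).comm n (n - 1)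
    dsimp only [Functor.const_obj_obj] at this
    rw [Category.assoc, Category.assoc, this, HomologicalComplex.Hom.comm_assoc, reassoc_of% h₃,
      reassoc_of% h₅, hι, hι, he₀]
  · rw [Category.assoc, Category.assoc, haug, ← h₆, h₄]

theorem hasFunctorialCofibrantReplacements_of_hasEnoughSmallProjectives [HasColimits A]
    {κ : Cardinal.{v}} (hκ : 𝓟.HasEnoughSmallProjectives κ) (hR : 𝓟.HasFunctorialResolutions) :
    𝓟.HasFunctorialCofibrantReplacements := by
  obtain ⟨R, π, h⟩ := hR
  -- An infinite successor cardinal is regular, so its initial ordinal has cofinality greater than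
  -- `κ` and no last element.
  let c : Cardinal.{v} := Order.succ (max κ Cardinal.aleph0)
  have hc : c.IsRegular := Cardinal.isRegular_succ (le_max_right _ _)
  let J := c.ord.ToType
  have : Nonempty J := Ordinal.nonempty_toType_iff.2 hc.ord_pos.ne'
  have : OrderBot J := WellFoundedLT.toOrderBot J
  have : NoMaxOrder J := Cardinal.noMaxOrder hc.aleph0_le
  have hJ : κ < Order.cof J := by
    rw [Ordinal.cof_toType, hc.cof_ord]
    exact (le_max_left _ _).trans_lt (Order.lt_succ _)
  obtain ⟨Q, q, hq⟩ := 𝓟.exists_attachTower (cyclesCoverπ π) J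
    (fun Z => 𝓟.isCofibrant_ofGraded fun n => (h _).proj 0)
  refine ⟨Q, q, fun X => ⟨(hq X).1, ?_⟩⟩
  obtain ⟨T⟩ := (hq X).2
  refine (𝓟.trivialFibrations_iff _).2 fun P hP => (liftsCycles_iff _).2 fun n =>
    (𝓟.epi_iff _).1 (hκ _ fun S hS hS' => ?_) P hP
  refine (liftsCycles_iff _).1 (T.liftsCycles 𝓟 hJ (fun M x => ?_) hS') n
  exact (((h M).exact_target.2 S hS) x).1 comp_zero

end ProjectiveClass

/-! ### Sequential colimits of split monomorphisms -/

section Telescope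

variable {A : Type u} [Category.{v} A]

/-- The maps `c k : G k ⟶ L` exhibit `L` as the colimit of the sequence with
transition maps `s k : G k ⟶ G (k + 1)`. -/
structure IsSequentialColimit {G : ℕ → A} (s : ∀ k, G k ⟶ G (k + 1)) {L : A}
    (c : ∀ k, G k ⟶ L) : Prop where
  w (k : ℕ) : s k ≫ c (k + 1) = c k
  hom_ext {Y : A} {a b : L ⟶ Y} (h : ∀ k, c k ≫ a = c k ≫ b) : a = b
  exists_desc {Y : A} (g : ∀ k, G k ⟶ Y) (hg : ∀ k, s k ≫ g (k + 1) = g k) :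
    ∃ l : L ⟶ Y, ∀ k, c k ≫ l = g k

lemma IsSequentialColimit.of_isColimit {F : ℕ ⥤ A} {c : Cocone F} (hc : IsColimit c) :
    IsSequentialColimit (fun k => F.map (homOfLE k.le_succ)) c.ι.app where
  w k := c.w _
  hom_ext h := hc.hom_ext h
  exists_desc g hg := by
    let α : F ⟶ (Functor.const ℕ).obj _ := NatTrans.ofSequence g (fun k => by
      exact (hg k).trans (Category.comp_id _).symm)
    exact ⟨hc.desc (Cocone.mk _ α), fun k => hc.fac _ k⟩

/-- The sequential colimit of split monomorphisms is the cokernel of a split monomorphism between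
coproducts. -/
lemma IsSequentialColimit.exists_splitting [Preadditive A] {G : ℕ → A}
    {s : ∀ k, G k ⟶ G (k + 1)} {L : A} {c : ∀ k, G k ⟶ L} (hc : IsSequentialColimit s c)
    {r : ∀ k, G (k + 1) ⟶ G k} (hr : ∀ k, s k ≫ r k = 𝟙 _) {T : A} {ι : ∀ k, G k ⟶ T}
    (hι : IsColimit (Cofan.mk T ι)) {S : T ⟶ T} (hS : ∀ k, ι k ≫ S = s k ≫ ι (k + 1))
    {π : T ⟶ L} (hπ : ∀ k, ι k ≫ π = c k) :
    ∃ (σ : L ⟶ T) (ρ : T ⟶ T), σ ≫ π = 𝟙 L ∧ ρ - S ≫ ρ = 𝟙 T ∧ ρ - ρ ≫ S + π ≫ σ = 𝟙 T := by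
  have hext {Y : A} {a b : T ⟶ Y} (h : ∀ k, ι k ≫ a = ι k ≫ b) : a = b :=
    Cofan.IsColimit.hom_ext hι _ _ h
  -- The recursion solves `(1 - S) ≫ ρ = 1` on each summand, starting from `0`.
  let ρ' : ∀ k, G k ⟶ T := fun k => Nat.rec 0 (fun k ρ => r k ≫ (ρ - ι k)) k
  let ρ : T ⟶ T := Cofan.IsColimit.desc hι ρ'
  have hρ (k : ℕ) : ι k ≫ ρ = ρ' k := Cofan.IsColimit.fac hι ρ' k
  have hρS : ρ - S ≫ ρ = 𝟙 T := hext fun k => by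
    rw [Preadditive.comp_sub, reassoc_of% hS, hρ, hρ]
    change _ - s k ≫ r k ≫ (ρ' k - ι k) = _
    rw [reassoc_of% hr, sub_sub_cancel, Category.comp_id]
  have hSπ : S ≫ π = π := hext fun k => by
    rw [reassoc_of% hS, hπ, hπ, hc.w]
  -- The map `1 - ρ ≫ (1 - S)` is unchanged by precomposition with `S`, so it descends to the
  -- colimit.
  obtain ⟨σ, hσ⟩ := hc.exists_desc (fun k => ι k ≫ (𝟙 T - (ρ - ρ ≫ S))) (fun k => by
    have h₁ : S ≫ ρ = ρ - 𝟙 T := by rw [← hρS, sub_sub_cancel]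
    have h₂ : S ≫ (𝟙 T - (ρ - ρ ≫ S)) = 𝟙 T - (ρ - ρ ≫ S) := by
      simp only [Preadditive.comp_sub, Preadditive.sub_comp, Category.comp_id, Category.id_comp,
        reassoc_of% h₁, h₁]
      abel
    rw [← reassoc_of% hS, h₂])
  refine ⟨σ, ρ, hc.hom_ext fun k => ?_, hρS, hext fun k => ?_⟩
  · rw [reassoc_of% hσ]
    simp [Preadditive.sub_comp, hSπ, hπ]
  · rw [Preadditive.comp_add, reassoc_of% hπ, hσ, Preadditive.comp_sub _ (𝟙 T)]
    abel

end Telescope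

section Acyclic

variable {B : Type u₂} [Category.{v₂} B] [Preadditive B]

/-- A complex `L` is acyclic if it is the cokernel of a degreewise split monomorphism `1 - S` of a
complex `T` for which `S` is null-homotopic. -/
lemma exists_boundary_of_telescope {L T : ChainComplex B ℤ} (S : T ⟶ T) (π : T ⟶ L)
    (hSπ : S ≫ π = π) (σ : ∀ n, L.X n ⟶ T.X n) (ρ : ∀ n, T.X n ⟶ T.X n)
    (hσ : ∀ n, σ n ≫ π.f n = 𝟙 _) (hρ : ∀ n, ρ n - S.f n ≫ ρ n = 𝟙 _)
    (hρσ : ∀ n, ρ n - ρ n ≫ S.f n + π.f n ≫ σ n = 𝟙 _)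
    (H : ∀ n, T.X (n - 1) ⟶ T.X n)
    (hH : ∀ n, H n ≫ T.d n (n - 1) + T.d (n - 1) (n - 1 - 1) ≫ H (n - 1) = S.f (n - 1))
    {M : B} {n : ℤ} (z : M ⟶ L.X (n - 1)) (hz : z ≫ L.d (n - 1) (n - 1 - 1) = 0) :
    ∃ y : M ⟶ L.X n, y ≫ L.d n (n - 1) = z := by
  have hSπ' (m : ℤ) : S.f m ≫ π.f m = π.f m := congr_arg (fun g => HomologicalComplex.Hom.f g m) hSπ
  -- Connecting map: the boundary `w` of the lift `z ≫ σ` dies in `L`, so it equals `v ≫ (1 - S)`,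
  -- and `v` is a cycle since `1 - S` is split mono.
  obtain ⟨w, hw₀⟩ : ∃ w, w = z ≫ σ (n - 1) ≫ T.d (n - 1) (n - 1 - 1) := ⟨_, rfl⟩
  obtain ⟨v, hv₀⟩ : ∃ v, v = w ≫ ρ (n - 1 - 1) := ⟨_, rfl⟩
  have hw : w = v - v ≫ S.f (n - 1 - 1) := by
    have h₁ : w ≫ π.f (n - 1 - 1) = 0 := by
      simp only [hw₀, Category.assoc, ← π.comm]
      rw [reassoc_of% hσ, hz]
    have h₂ := w ≫= hρσ (n - 1 - 1)
    rw [Preadditive.comp_add, Preadditive.comp_sub, reassoc_of% h₁, zero_comp, add_zero,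
      Category.comp_id] at h₂
    rw [hv₀, Category.assoc, h₂]
  have hv : v ≫ T.d (n - 1 - 1) (n - 1 - 1 - 1) = 0 := by
    have h₁ : w ≫ T.d (n - 1 - 1) (n - 1 - 1 - 1) = 0 := by simp [hw₀]
    rw [hw, Preadditive.sub_comp, Category.assoc, S.comm] at h₁
    have h₂ := (v ≫ T.d (n - 1 - 1) (n - 1 - 1 - 1)) ≫= hρ _
    rw [Preadditive.comp_sub, ← Category.assoc _ (S.f _), ← Preadditive.sub_comp, Category.assoc,
      h₁, zero_comp, Category.comp_id] at h₂
    exact h₂.symm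
  have hvS : v ≫ S.f (n - 1 - 1) = v ≫ H (n - 1) ≫ T.d (n - 1) (n - 1 - 1) := by
    rw [← hH, Preadditive.comp_add, reassoc_of% hv, zero_comp, add_zero]
  -- As `S ≫ π = π`, the cycle `z` is `z ≫ σ ≫ S ≫ π`. The homotopy makes this the boundary of `z ≫
  -- σ ≫ H ≫ π` plus `w ≫ H ≫ π`, which is the boundary of `v ≫ H ≫ H ≫ π` because `(1 - S) ≫ π =
  -- 0`.
  refine ⟨v ≫ H (n - 1) ≫ H n ≫ π.f n + z ≫ σ (n - 1) ≫ H n ≫ π.f n, ?_⟩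
  have h₁ : z = z ≫ σ (n - 1) ≫ S.f (n - 1) ≫ π.f (n - 1) := by
    rw [hSπ', hσ, Category.comp_id]
  have h₂ : w ≫ H (n - 1) =
      v ≫ H (n - 1) - v ≫ H (n - 1) ≫ T.d (n - 1) (n - 1 - 1) ≫ H (n - 1) := by
    rw [hw, Preadditive.sub_comp, hvS]
    simp only [Category.assoc]
  have h₃ : T.d (n - 1) (n - 1 - 1) ≫ H (n - 1) = S.f (n - 1) - H n ≫ T.d n (n - 1) := by
    rw [← hH n]
    abel
  have h₄ : w ≫ H (n - 1) ≫ π.f (n - 1) = v ≫ H (n - 1) ≫ H n ≫ T.d n (n - 1) ≫ π.f (n - 1) := by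
    rw [reassoc_of% h₂, h₃, Preadditive.sub_comp]
    simp [Preadditive.comp_sub, Preadditive.sub_comp, hSπ']
  conv_rhs => rw [h₁, ← hH n]
  simp only [Preadditive.add_comp, Preadditive.comp_add, Category.assoc, π.comm]
  rw [← h₄, add_comm]
  simp only [hw₀, Category.assoc]

end Acyclic

/-! ### Sections of maps that lift cycles, and cones along a sequence. -/

namespace ChainComplex

section

variable {A : Type u} [Category.{v} A] [Abelian A]

/-- If `(y₁, y₂)` bounds the cycle `(x, e)` of the cone and `a` lifts `y₁`, then `d a - y₂` is a
solution. -/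
lemma LiftsCycles.of_cone {P : A} {E X : ChainComplex A ℤ} {f : E ⟶ X}
    (hc : ∀ (n : ℤ) (z : P ⟶ (cone f).X (n - 1)), z ≫ (cone f).d (n - 1) (n - 1 - 1) = 0 →
      ∃ y : P ⟶ (cone f).X n, y ≫ (cone f).d n (n - 1) = z)
    (hf : ∀ n, IsEpicFor P (f.f n)) : LiftsCycles P f := by
  intro i j k hij hjk e x he hx
  obtain ⟨n, rfl⟩ : ∃ n, i = n - 1 := ⟨i + 1, by ring⟩
  obtain rfl : j = n - 1 - 1 := by omega
  obtain rfl : k = n - 1 - 1 - 1 := by omega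
  obtain ⟨y, hy⟩ := hc n (coneLift f x e) (coneLift_d_eq_zero f x e he hx)
  have h₁ := hy =≫ coneFst f (n - 1)
  have h₂ := hy =≫ coneSnd f (n - 1)
  simp only [Category.assoc, cone_d_fst, cone_d_snd, coneLift_fst, coneLift_snd,
    Preadditive.comp_sub, Preadditive.comp_neg] at h₁ h₂
  obtain ⟨a, ha⟩ := hf n (y ≫ coneFst f n)
  have ha' : a ≫ f.f n = y ≫ coneFst f n := ha
  refine ⟨a ≫ E.d n (n - 1) - y ≫ coneSnd f n, ?_, ?_⟩
  · simp [Preadditive.sub_comp, h₂]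
  · simp [Preadditive.sub_comp, ← h₁, ← reassoc_of% ha']

lemma coneFst_inl_add_coneSnd_inr {E X : ChainComplex A ℤ} (f : E ⟶ X) (n : ℤ) :
    coneFst f n ≫ (coneInl f).f n + coneSnd f n ≫ coneLift f 0 (𝟙 _) = 𝟙 _ := by
  apply cone_hom_ext <;> simp [Preadditive.add_comp]

lemma coneInl_f_map_id {E E' X : ChainComplex A ℤ} {f : E ⟶ X} {f' : E' ⟶ X} (a : E ⟶ E')
    (w : f ≫ 𝟙 X = a ≫ f') (n : ℤ) :
    (coneInl f).f n ≫ (coneMap a (𝟙 X) w).f n = (coneInl f').f n :=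
  (congr_arg (fun g => HomologicalComplex.Hom.f g n) (coneInl_map a (𝟙 X) w)).trans
    (Category.id_comp _)

lemma coneInr_map_f {E X E' X' : ChainComplex A ℤ} {f : E ⟶ X} {f' : E' ⟶ X'} (a : E ⟶ E')
    (b : X ⟶ X') (w : f ≫ b = a ≫ f') (n : ℤ) :
    coneLift f 0 (𝟙 _) ≫ (coneMap a b w).f n = a.f (n - 1) ≫ coneLift f' 0 (𝟙 _) := by
  apply cone_hom_ext <;> simp

/-- A chain map in an abelian category that lifts cycles for all objects has a section. -/
lemma exists_section_of_liftsCycles {W V : ChainComplex A ℤ} {p : W ⟶ V}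
    (hp : ∀ M, LiftsCycles M p) : ∃ s : V ⟶ W, s ≫ p = 𝟙 V := by
  have hθ (n : ℤ) : ∃ θ : cyclePairs p n ⟶ W.X n, θ ≫ toCyclePairs p n = 𝟙 _ :=
    (liftsCycles_iff p).1 (hp _) n (𝟙 _)
  choose θ hθ using hθ
  have hθ₁ (n : ℤ) : θ n ≫ W.d n (n - 1) = cyclePairsFst p n := by
    rw [← toCyclePairs_fst, reassoc_of% hθ]
  have hθ₂ (n : ℤ) : θ n ≫ p.f n = cyclePairsSnd p n := by
    rw [← toCyclePairs_snd, reassoc_of% hθ]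
  -- The choice `θ` is applied twice: to `(0, d v)`, giving a cycle over `d v`, then to that cycle
  -- paired with `v`. On a boundary the first application gives zero, which makes the section a
  -- chain map.
  have h₁ (n : ℤ) := exists_cyclePairs_lift p (n - 1) (0 : V.X n ⟶ _) (V.d n (n - 1))
    (by simp) (by simp)
  choose a ha₁ ha₂ using h₁
  have h₂ (n : ℤ) := exists_cyclePairs_lift p n (a n ≫ θ (n - 1)) (𝟙 _)
    (by simp [hθ₁, ha₁]) (by simp [hθ₂, ha₂])
  choose b hb₁ hb₂ using h₂
  refine ⟨homMk (fun n => b n ≫ θ n) (fun n => ?_), ?_⟩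
  · have h₃ : V.d n (n - 1) ≫ a (n - 1) = 0 :=
      cyclePairs_hom_ext (by simp [ha₁]) (by simp [ha₂])
    have h₄ : V.d n (n - 1) ≫ b (n - 1) = a n :=
      cyclePairs_hom_ext (by simp [hb₁, reassoc_of% h₃, ha₁]) (by simp [hb₂, ha₂])
    rw [Category.assoc, hθ₁, hb₁, reassoc_of% h₄]
  · ext n
    simp [hθ₂, hb₂]

/-- In each degree the cone is a constant term `X` plus a shifted term of `E`; on the constant part,
a compatible family is fixed by its value at `k = 0`. -/
lemma isSequentialColimit_cone {E : ℕ → ChainComplex A ℤ} {s : ∀ k, E k ⟶ E (k + 1)}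
    {X : ChainComplex A ℤ} {a : ∀ k, E k ⟶ X} (ha : ∀ k, s k ≫ a (k + 1) = a k)
    {Q : ChainComplex A ℤ} {c : ∀ k, E k ⟶ Q} {q : Q ⟶ X} (hq : ∀ k, c k ≫ q = a k) (n : ℤ)
    (h : IsSequentialColimit (fun k => (s k).f (n - 1)) (fun k => (c k).f (n - 1))) :
    IsSequentialColimit
      (fun k => (coneMap (f := a k) (f' := a (k + 1)) (s k) (𝟙 X) (by simp [ha])).f n)
      (fun k => (coneMap (f := a k) (f' := q) (c k) (𝟙 X) (by simp [hq])).f n) where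
  w k := by
    apply cone_hom_ext
    · simp
    · simp [coneMap_f_snd_assoc, h.w]
  hom_ext {Y b₁ b₂} hb := by
    have hinl (k : ℕ) : (coneInl (a k)).f n ≫
        (coneMap (f := a k) (f' := q) (c k) (𝟙 X) (by simp [hq])).f n = (coneInl q).f n :=
      coneInl_f_map_id _ _ n
    have hinr (k : ℕ) : coneLift (a k) 0 (𝟙 _) ≫
        (coneMap (f := a k) (f' := q) (c k) (𝟙 X) (by simp [hq])).f n =
          (c k).f (n - 1) ≫ coneLift q 0 (𝟙 _) :=
      coneInr_map_f _ _ _ n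
    have h₁ : (coneInl q).f n ≫ b₁ = (coneInl q).f n ≫ b₂ := by
      rw [← hinl 0, Category.assoc, hb, Category.assoc]
    have h₂ : coneLift q 0 (𝟙 (Q.X (n - 1))) ≫ b₁ = coneLift q 0 (𝟙 _) ≫ b₂ := h.hom_ext fun k => by
      rw [← reassoc_of% hinr k, hb, reassoc_of% hinr k]
    rw [← Category.id_comp b₁, ← Category.id_comp b₂, ← coneFst_inl_add_coneSnd_inr]
    simp [Preadditive.add_comp, h₁, h₂]
  exists_desc g hg := by
    have hinl (k : ℕ) : (coneInl (a k)).f n ≫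
        (coneMap (f := a k) (f' := a (k + 1)) (s k) (𝟙 X) (by simp [ha])).f n =
          (coneInl (a (k + 1))).f n :=
      coneInl_f_map_id _ _ n
    have hinr (k : ℕ) : coneLift (a k) 0 (𝟙 _) ≫
        (coneMap (f := a k) (f' := a (k + 1)) (s k) (𝟙 X) (by simp [ha])).f n =
          (s k).f (n - 1) ≫ coneLift (a (k + 1)) 0 (𝟙 _) :=
      coneInr_map_f _ _ _ n
    obtain ⟨l, hl⟩ := h.exists_desc (fun k => coneLift (a k) 0 (𝟙 _) ≫ g k) (fun k => by
      rw [← reassoc_of% hinr k, hg])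
    have h₁ (k : ℕ) : (coneInl (a k)).f n ≫ g k = (coneInl (a 0)).f n ≫ g 0 := by
      induction k with
      | zero => rfl
      | succ k hk => rw [← hinl, Category.assoc, hg, hk]
    refine ⟨coneFst q n ≫ (coneInl (a 0)).f n ≫ g 0 + coneSnd q n ≫ l, fun k => ?_⟩
    conv_rhs => rw [← Category.id_comp (g k), ← coneFst_inl_add_coneSnd_inr]
    simp [Preadditive.add_comp, Preadditive.comp_add, coneMap_f_fst_assoc, coneMap_f_snd_assoc,
      hl, h₁]

end

end ChainComplex

/-! ### Case A: the null-homotopy argument. -/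

namespace ChainComplex

variable {A : Type u} [Category.{v} A] [Abelian A] {B : Type u₂} [Category.{v₂} B] [Abelian B]
  {F : B ⥤ A} {U : A ⥤ B} [U.Additive]

lemma LiftsCycles.of_leftAdjoint (adj : F ⊣ U) {M : B} {E X : ChainComplex A ℤ} {f : E ⟶ X}
    (h : LiftsCycles (F.obj M) f) :
    LiftsCycles M ((U.mapHomologicalComplex (ComplexShape.down ℤ)).map f) := by
  intro i j k hij hjk (e : M ⟶ U.obj (E.X j)) (x : M ⟶ U.obj (X.X i))
    (he : e ≫ U.map (E.d j k) = 0) (hx : e ≫ U.map (f.f j) = x ≫ U.map (X.d i j))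
  obtain ⟨e', h₁, h₂⟩ := h i j k hij hjk ((adj.homEquiv _ _).symm e) ((adj.homEquiv _ _).symm x)
    (by
        rw [← adj.homEquiv_naturality_right_symm, he, Equiv.symm_apply_eq]
        simp [adj.homEquiv_unit])
    (by rw [← adj.homEquiv_naturality_right_symm, hx, adj.homEquiv_naturality_right_symm])
  refine ⟨adj.homEquiv _ _ e', ?_, ?_⟩
  · change _ ≫ U.map (E.d i j) = _
    rw [← adj.homEquiv_naturality_right, h₁, Equiv.apply_symm_apply]
  · change _ ≫ U.map (f.f i) = _
    rw [← adj.homEquiv_naturality_right, h₂, Equiv.apply_symm_apply]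

/-- The null-homotopy argument for towers: cycles lift to the colimit if up to `U` each cycle lifts
to the next step. -/
lemma liftsCycles_of_sequentialColimit (adj : F ⊣ U) [HasCoproductsOfShape ℕ A]
    [PreservesColimitsOfShape (Discrete ℕ) U] {E : ℕ → ChainComplex A ℤ}
    {s : ∀ k, E k ⟶ E (k + 1)} {X : ChainComplex A ℤ} {a : ∀ k, E k ⟶ X}
    (ha : ∀ k, s k ≫ a (k + 1) = a k) {Q : ChainComplex A ℤ} {c : ∀ k, E k ⟶ Q} {q : Q ⟶ X}
    (hq : ∀ k, c k ≫ q = a k)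
    (hc : ∀ n, IsSequentialColimit (fun k => (s k).f n) (fun k => (c k).f n))
    (hs : ∀ k n, ∃ r, (s k).f n ≫ r = 𝟙 _)
    (h : ∀ k n, U.obj ((cone (a k)).X n) ⟶ U.obj ((E (k + 1)).X n))
    (h₁ : ∀ k n, h k n ≫ U.map ((E (k + 1)).d n (n - 1)) =
      U.map ((cone (a k)).d n (n - 1)) ≫ h k (n - 1) + U.map (coneSnd (a k) n ≫ (s k).f (n - 1)))
    (h₂ : ∀ k n, h k n ≫ U.map ((a (k + 1)).f n) = U.map (coneFst (a k) n)) (M : B) :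
    LiftsCycles (F.obj M) q := by
  choose r hr using hs
  let t (k : ℕ) : cone (a k) ⟶ cone (a (k + 1)) := coneMap (s k) (𝟙 X) (by simp [ha])
  let G (k : ℕ) : ChainComplex A ℤ := cone (a k)
  let T : ChainComplex A ℤ := ∐ G
  let S : T ⟶ T := Sigma.desc fun k => t k ≫ Sigma.ι G (k + 1)
  let π : T ⟶ cone q := Sigma.desc fun k => coneMap (c k) (𝟙 X) (by simp [hq])
  have hT (n : ℤ) : IsColimit (Cofan.mk (T.X n) fun k => (Sigma.ι G k).f n) :=
    isColimitOfHasCoproductOfPreservesColimit (HomologicalComplex.eval A _ n) G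
  have hUT (n : ℤ) : IsColimit (Cofan.mk (U.obj (T.X n)) fun k => U.map ((Sigma.ι G k).f n)) :=
    isColimitCofanMkObjOfIsColimit U _ _ (hT n)
  have hιS (k : ℕ) (n : ℤ) : (Sigma.ι G k).f n ≫ S.f n = (t k).f n ≫ (Sigma.ι G (k + 1)).f n := by
    rw [← HomologicalComplex.comp_f, ← HomologicalComplex.comp_f, Sigma.ι_desc]
  have hιπ (k : ℕ) (n : ℤ) : (Sigma.ι G k).f n ≫ π.f n =
      (coneMap (f := a k) (f' := q) (c k) (𝟙 X) (by simp [hq])).f n := by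
    rw [← HomologicalComplex.comp_f, Sigma.ι_desc]
  have hsplit (n : ℤ) := (isSequentialColimit_cone ha hq n (hc _)).exists_splitting
    (r := fun k => coneLift (a k) (coneFst _ n) (coneSnd _ n ≫ r k (n - 1)))
    (fun k => by apply cone_hom_ext <;> simp [coneMap_f_snd_assoc, hr]) (hT n)
    (fun k => hιS k n) (fun k => hιπ k n)
  choose σ ρ hσ hρ hρσ using hsplit
  have hSπ : S ≫ π = π := Sigma.hom_ext _ _ fun k => by
    rw [Sigma.ι_desc_assoc, Category.assoc, Sigma.ι_desc, Sigma.ι_desc]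
    exact HomologicalComplex.hom_ext _ _ fun n => (isSequentialColimit_cone ha hq n (hc _)).w k
  -- Up to sign, `h` followed by the inclusion of `E (k + 1)` into the next cone is a null-homotopy
  -- of `U (t k)`: `h₂` yields its part through `X`, `h₁` the part through `E`.
  let H (n : ℤ) : U.obj (T.X (n - 1)) ⟶ U.obj (T.X n) := Cofan.IsColimit.desc (hUT (n - 1)) fun k =>
    -(h k (n - 1) ≫ U.map (coneLift (a (k + 1)) 0 (𝟙 _) ≫ (Sigma.ι G (k + 1)).f n))
  have hH₀ (k : ℕ) (n : ℤ) : U.map ((Sigma.ι G k).f (n - 1)) ≫ H n =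
      -(h k (n - 1) ≫ U.map (coneLift (a (k + 1)) 0 (𝟙 _) ≫ (Sigma.ι G (k + 1)).f n)) :=
    Cofan.IsColimit.fac (hUT (n - 1)) _ k
  have hH (n : ℤ) : H n ≫ U.map (T.d n (n - 1)) + U.map (T.d (n - 1) (n - 1 - 1)) ≫ H (n - 1) =
      U.map (S.f (n - 1)) := by
    refine Cofan.IsColimit.hom_ext (hUT (n - 1)) _ _ fun k => ?_
    change U.map ((Sigma.ι G k).f (n - 1)) ≫ _ = U.map ((Sigma.ι G k).f (n - 1)) ≫ _
    have h₃ : coneLift (a (k + 1)) 0 (𝟙 _) ≫ (cone (a (k + 1))).d n (n - 1) =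
        -((a (k + 1)).f (n - 1) ≫ (coneInl (a (k + 1))).f (n - 1) +
          (E (k + 1)).d (n - 1) (n - 1 - 1) ≫ coneLift (a (k + 1)) 0 (𝟙 _)) := by
      apply cone_hom_ext
      · simp [cone_d_fst, Preadditive.comp_sub, Preadditive.add_comp]
      · simp [cone_d_snd, Preadditive.add_comp]
    have h₄ : (t k).f (n - 1) = coneFst _ _ ≫ (coneInl (a (k + 1))).f (n - 1) +
        coneSnd _ _ ≫ (s k).f (n - 1 - 1) ≫ coneLift (a (k + 1)) 0 (𝟙 _) := by
      apply cone_hom_ext <;> simp [t, Preadditive.add_comp]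
    have h₅ : U.map ((Sigma.ι G k).f (n - 1)) ≫ U.map (T.d (n - 1) (n - 1 - 1)) =
        U.map ((G k).d (n - 1) (n - 1 - 1)) ≫ U.map ((Sigma.ι G k).f (n - 1 - 1)) := by
      rw [← U.map_comp, HomologicalComplex.Hom.comm, U.map_comp]
    rw [Preadditive.comp_add, reassoc_of% hH₀, reassoc_of% h₅, hH₀, ← U.map_comp, hιS, h₄]
    have h₆ := h₁ k (n - 1) =≫ U.map (coneLift (a (k + 1)) 0 (𝟙 _) ≫ (Sigma.ι G (k + 1)).f (n - 1))
    have h₇ := h₂ k (n - 1) =≫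
      U.map ((coneInl (a (k + 1))).f (n - 1) ≫ (Sigma.ι G (k + 1)).f (n - 1))
    have h₈ := h₃ =≫ (Sigma.ι G (k + 1)).f (n - 1)
    simp only [Category.assoc, Preadditive.add_comp, Preadditive.neg_comp] at h₆ h₇ h₈
    rw [Preadditive.neg_comp, Category.assoc, ← U.map_comp, Category.assoc,
      HomologicalComplex.Hom.comm, h₈]
    simp only [Preadditive.comp_add, Preadditive.comp_neg, Preadditive.add_comp, Category.assoc,
      U.map_add, U.map_neg, U.map_comp] at h₆ h₇ ⊢
    rw [h₆, h₇]
    abel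
  -- The splitting is given by equations, which an additive functor preserves; `U` has to preserve
  -- only the coproduct `T`, not the sequential colimit.
  have hUσ (n : ℤ) : U.map (σ n) ≫ U.map (π.f n) = 𝟙 (U.obj ((cone q).X n)) := by
    rw [← U.map_comp, hσ, U.map_id]
  have hUρ (n : ℤ) : U.map (ρ n) - U.map (S.f n) ≫ U.map (ρ n) = 𝟙 (U.obj (T.X n)) := by
    rw [← U.map_comp, ← U.map_sub, hρ, U.map_id]
  have hUρσ (n : ℤ) : U.map (ρ n) - U.map (ρ n) ≫ U.map (S.f n) + U.map (π.f n) ≫ U.map (σ n) =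
      𝟙 (U.obj (T.X n)) := by
    rw [← U.map_comp, ← U.map_comp, ← U.map_sub, ← U.map_add, hρσ, U.map_id]
  refine .of_cone (fun n z hz => ?_) fun n x => ?_
  · obtain ⟨(y : M ⟶ U.obj ((cone q).X n)), hy⟩ := exists_boundary_of_telescope
      ((U.mapHomologicalComplex (ComplexShape.down ℤ)).map S)
      ((U.mapHomologicalComplex (ComplexShape.down ℤ)).map π)
      (by rw [← Functor.map_comp, hSπ]) (fun n => U.map (σ n)) (fun n => U.map (ρ n))
      hUσ hUρ hUρσ H hH
      (adj.homEquiv _ _ z) (by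
        change _ ≫ U.map ((cone q).d (n - 1) (n - 1 - 1)) = 0
        rw [← adj.homEquiv_naturality_right, hz]
        simp [adj.homEquiv_unit])
    have hy' : y ≫ U.map ((cone q).d n (n - 1)) = adj.homEquiv _ _ z := hy
    exact ⟨(adj.homEquiv _ _).symm y, by
      rw [← adj.homEquiv_naturality_right_symm, hy', Equiv.symm_apply_apply]⟩
  -- The element `(x, 0)` of the first cone is carried by `h 0` to a lift of `x` in `E 1`.
  · refine ⟨(adj.homEquiv _ _).symm (adj.homEquiv _ _ x ≫ U.map (coneLift (a 0) (𝟙 _) 0) ≫ h 0 n ≫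
      U.map ((c 1).f n)), ?_⟩
    change _ ≫ q.f n = x
    have : (c 1).f n ≫ q.f n = (a 1).f n :=
      congr_arg (fun g => HomologicalComplex.Hom.f g n) (hq 1)
    rw [← adj.homEquiv_naturality_right_symm, Category.assoc, Category.assoc, Category.assoc,
      ← U.map_comp, this, h₂ 0 n, ← U.map_comp, coneLift_fst, U.map_id, Category.comp_id,
      Equiv.symm_apply_apply]

end ChainComplex

/-! ### Case A: attaching along the counit. -/

namespace ChainComplex

section

variable {A : Type u} [Category.{v} A] [Abelian A] {E X K : ChainComplex A ℤ} {f : E ⟶ X}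
  (q : K ⟶ cone f)

/-- The inclusion of the graded object `K` into the extension of `K` by `E`. -/
noncomputable def attachInr (n : ℤ) : K.X n ⟶ (attach q).X n :=
  attachLift q 0 (𝟙 _)

lemma attachInr_d (n : ℤ) : attachInr q n ≫ (attach q).d n (n - 1) =
    K.d n (n - 1) ≫ attachInr q (n - 1) + q.f n ≫ coneSnd f n ≫ (attachInl q).f (n - 1) := by
  apply attach_hom_ext
  · simp [attachInr, attach_d_fst, Preadditive.add_comp]
  · simp [attachInr, attach_d_snd, Preadditive.add_comp]

lemma attachInr_desc (n : ℤ) : attachInr q n ≫ (attachDesc q).f n = q.f n ≫ coneFst f n := by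
  simp [attachInr, attachDesc_f]

end

section

variable {A : Type u} [Category.{v} A] [Abelian A] {B : Type u₂} [Category.{v₂} B] [Abelian B]
  {F : B ⥤ A} {U : A ⥤ B} [F.Additive] [U.Additive] (adj : F ⊣ U)

/-- The counit of an adjunction, applied degreewise to chain complexes. -/
noncomputable def counitComplex : U.mapHomologicalComplex (ComplexShape.down ℤ) ⋙
    F.mapHomologicalComplex (ComplexShape.down ℤ) ⟶ 𝟭 (ChainComplex A ℤ) where
  app X :=
    { f n := adj.counit.app (X.X n)
      comm' i j _ := (adj.counit.naturality (X.d i j)).symm }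
  naturality _ _ φ := by
    ext n
    exact adj.counit.naturality (φ.f n)

variable {E X : ChainComplex A ℤ} (f : E ⟶ X)

/-- The inclusion of the graded object attached to `E` along the counit. -/
noncomputable def attachCounitInr (n : ℤ) :
    F.obj (U.obj ((cone f).X n)) ⟶ (attach ((counitComplex adj).app (cone f))).X n :=
  attachInr ((counitComplex adj).app (cone f)) n

/-- The unit splits `U` of the counit, so it carries `U (cone f)` into the part attached at the next
step. Together with `unit_attachCounitInr_desc` this supplies the data `h` of
`liftsCycles_of_sequentialColimit`. -/
lemma unit_attachCounitInr_d (n : ℤ) :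
    adj.unit.app (U.obj ((cone f).X n)) ≫ U.map (attachCounitInr adj f n ≫
        (attach ((counitComplex adj).app (cone f))).d n (n - 1)) =
      U.map ((cone f).d n (n - 1)) ≫ adj.unit.app (U.obj ((cone f).X (n - 1))) ≫
        U.map (attachCounitInr adj f (n - 1)) +
        U.map (coneSnd f n ≫ (attachInl ((counitComplex adj).app (cone f))).f (n - 1)) := by
  have h : attachCounitInr adj f n ≫ (attach ((counitComplex adj).app (cone f))).d n (n - 1) =
      F.map (U.map ((cone f).d n (n - 1))) ≫ attachCounitInr adj f (n - 1) +
        CategoryStruct.comp (X := F.obj (U.obj ((cone f).X n))) (adj.counit.app ((cone f).X n))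
          (coneSnd f n ≫ (attachInl ((counitComplex adj).app (cone f))).f (n - 1)) :=
    attachInr_d _ n
  rw [h, U.map_add, Preadditive.comp_add, U.map_comp, U.map_comp (adj.counit.app _),
    adj.right_triangle_components_assoc, ← adj.unit_naturality_assoc]

lemma unit_attachCounitInr_desc (n : ℤ) :
    adj.unit.app (U.obj ((cone f).X n)) ≫ U.map (attachCounitInr adj f n ≫
      (attachDesc ((counitComplex adj).app (cone f))).f n) = U.map (coneFst f n) := by
  have h : attachCounitInr adj f n ≫ (attachDesc ((counitComplex adj).app (cone f))).f n =
      adj.counit.app ((cone f).X n) ≫ coneFst f n := attachInr_desc _ n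
  rw [h, U.map_comp, adj.right_triangle_components_assoc]

end

end ChainComplex

namespace ProjectiveClass

open ChainComplex

variable {A : Type u} [Category.{v} A] [Abelian A] {B : Type u₂} [Category.{v₂} B] [Abelian B]
  {F : B ⥤ A} {U : A ⥤ B} (adj : F ⊣ U)

/-- For a trivial fibration `p`, the map `U p` lifts cycles for every object of `B`, so it has a
section as a chain map. The transpose of `g` followed by this section transposes back to a lift. -/
lemma isCofibrant_pullback_trivial [F.Additive] [U.Additive] (Z : ChainComplex A ℤ) :
    ((trivial B).pullback adj).IsCofibrant ((F.mapHomologicalComplex (ComplexShape.down ℤ)).obj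
      ((U.mapHomologicalComplex (ComplexShape.down ℤ)).obj Z)) := by
  rw [isCofibrant_iff]
  intro W V p hp g
  rw [trivialFibrations_iff] at hp
  obtain ⟨s, hs⟩ := exists_section_of_liftsCycles fun M =>
    (hp (F.obj M) ⟨M, True.intro, ⟨Retract.refl _⟩⟩).of_leftAdjoint adj
  obtain ⟨γ, hγ⟩ : ∃ γ : ∀ n, F.obj (U.obj (Z.X n)) ⟶ V.X n, ∀ n, γ n = g.f n :=
    ⟨fun n => g.f n, fun _ => rfl⟩
  have hγd (n : ℤ) : γ n ≫ V.d n (n - 1) = F.map (U.map (Z.d n (n - 1))) ≫ γ (n - 1) := by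
    rw [hγ, hγ]
    exact g.comm _ _
  have hγd' (n : ℤ) : (adj.unit.app (U.obj (Z.X n)) ≫ U.map (γ n)) ≫ U.map (V.d n (n - 1)) =
      U.map (Z.d n (n - 1)) ≫ adj.unit.app (U.obj (Z.X (n - 1))) ≫ U.map (γ (n - 1)) := by
    rw [Category.assoc, ← U.map_comp, hγd, U.map_comp, ← adj.unit_naturality_assoc]
  let g' : (U.mapHomologicalComplex (ComplexShape.down ℤ)).obj Z ⟶
      (U.mapHomologicalComplex (ComplexShape.down ℤ)).obj V :=
    homMk (fun n => adj.unit.app (U.obj (Z.X n)) ≫ U.map (γ n)) hγd'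
  refine ⟨(F.mapHomologicalComplex _).map (g' ≫ s) ≫ (counitComplex adj).app W, ?_⟩
  have h : (counitComplex adj).app W ≫ p = (F.mapHomologicalComplex _).map
      ((U.mapHomologicalComplex _).map p) ≫ (counitComplex adj).app V :=
    ((counitComplex adj).naturality p).symm
  rw [Category.assoc, h, ← Functor.map_comp_assoc, Category.assoc, hs, Category.comp_id]
  ext n
  have hγε : F.map (adj.unit.app (U.obj (Z.X n)) ≫ U.map (γ n)) ≫ adj.counit.app (V.X n) = γ n := by
    simp
  exact hγε.trans (hγ n)

theorem hasFunctorialCofibrantReplacements_pullback_trivial [HasColimitsOfSize.{0, 0} A]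
    [PreservesColimitsOfShape (Discrete ℕ) U] :
    ((trivial B).pullback adj).HasFunctorialCofibrantReplacements := by
  -- Being adjoints, `F` and `U` preserve finite coproducts and finite products respectively, so
  -- both are additive.
  have : PreservesColimitsOfSize.{0, 0} F := adj.leftAdjoint_preservesColimits
  have : PreservesLimitsOfSize.{0, 0} U := adj.rightAdjoint_preservesLimits
  have := adj.isLeftAdjoint
  have := preservesBinaryBiproducts_of_preservesBinaryCoproducts F
  have : F.Additive := Functor.additive_of_preservesBinaryBiproducts _
  have : U.Additive := Functor.additive_of_preserves_binary_products _
  obtain ⟨Q, q, hq⟩ := ((trivial B).pullback adj).exists_attachTower (counitComplex adj) ℕ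
    (fun Z => isCofibrant_pullback_trivial adj Z)
  refine ⟨Q, q, fun X => ⟨(hq X).1, ?_⟩⟩
  obtain ⟨T⟩ := (hq X).2
  refine (trivialFibrations_iff _ _).2 ?_
  rintro P ⟨M, -, ⟨r⟩⟩
  refine .of_retract r ?_
  let s (k : ℕ) : T.F.obj k ⟶ T.F.obj (k + 1) := T.F.map (homOfLE k.le_succ)
  let θ (k : ℕ) : T.F.obj (k + 1) ≅ attach ((counitComplex adj).app (cone (T.aug k))) :=
    T.succIso k (not_isMax k)
  have hs (k : ℕ) : attachInl _ ≫ (θ k).inv = s k :=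
    ((Iso.eq_comp_inv _).2 (T.map_succIso k (not_isMax k))).symm
  have ha (k : ℕ) : (θ k).inv ≫ T.aug (k + 1) = attachDesc _ :=
    (Iso.inv_comp_eq _).2 (T.succIso_desc k (not_isMax k)).symm
  have hs' (k : ℕ) (n : ℤ) : (attachInl _).f n ≫ (θ k).inv.f n = (s k).f n :=
    congr_arg (fun g => HomologicalComplex.Hom.f g n) (hs k)
  have ha' (k : ℕ) (n : ℤ) : (θ k).inv.f n ≫ (T.aug (k + 1)).f n = (attachDesc _).f n :=
    congr_arg (fun g => HomologicalComplex.Hom.f g n) (ha k)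
  refine liftsCycles_of_sequentialColimit adj (s := s) (a := T.aug) (c := T.ι.app)
    (fun k => ?_) T.ι_comp (fun n => .of_isColimit
      (isColimitOfPreserves (HomologicalComplex.eval A _ n) T.isColimit))
    (fun k n => exists_retraction_of_cofibrations _ (T.cofibrations_map _) n)
    (fun k n => adj.unit.app _ ≫ U.map (attachCounitInr adj (T.aug k) n ≫ (θ k).inv.f n))
    (fun k n => ?_) (fun k n => ?_) M
  · rw [← hs, Category.assoc, ha, attachInl_desc]
  · rw [Category.assoc, ← U.map_comp, Category.assoc, HomologicalComplex.Hom.comm, ← hs',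
      ← Category.assoc, U.map_comp, ← Category.assoc, unit_attachCounitInr_d]
    simp
  · rw [Category.assoc, ← U.map_comp, Category.assoc, ha', unit_attachCounitInr_desc]

end ProjectiveClass

theorem mainTheorem1 {A : Type u} [Category.{v} A] [Abelian A] [HasLimits A] [HasColimits A]
    (𝓟 : ProjectiveClass A) :
    (FormsModelCategory 𝓟.equivalences 𝓟.fibrations 𝓟.cofibrations ↔
      𝓟.HasFunctorialCofibrantReplacements) ∧
    (FormsModelCategory 𝓟.equivalences 𝓟.fibrations 𝓟.cofibrations →
      IsProperStructure 𝓟.equivalences 𝓟.fibrations 𝓟.cofibrations) ∧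
    (∀ (B : Type u₂) [Category.{v₂} B] [Abelian B] (F : B ⥤ A) (U : A ⥤ B) (adj : F ⊣ U),
      (∀ (ι : Type) [Countable ι], PreservesColimitsOfShape (Discrete ι) U) →
      𝓟 = (ProjectiveClass.trivial B).pullback adj →
        𝓟.HasFunctorialCofibrantReplacements) ∧
    (∀ κ : Cardinal.{v}, 𝓟.HasEnoughSmallProjectives κ → 𝓟.HasFunctorialResolutions →
      𝓟.HasFunctorialCofibrantReplacements) := by
  refine ⟨⟨𝓟.hasFunctorialCofibrantReplacements_of_formsModelCategory,
    𝓟.formsModelCategory⟩, fun _ => 𝓟.isProperStructure, fun B _ _ F U adj hU h𝓟 => ?_,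
    fun κ hκ hR => 𝓟.hasFunctorialCofibrantReplacements_of_hasEnoughSmallProjectives hκ hR⟩
  have := hU ℕ
  have := hasColimitsOfSizeShrink.{0, 0, v, v} A
  rw [h𝓟]
  exact ProjectiveClass.hasFunctorialCofibrantReplacements_pullback_trivial adj
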